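/- For a domain $B\subset\mathbb R^n$ let $T_B=\mathbb R^n+iB\subset\mathbb C^n$, and for $0<p,s<\infty$ and $\psi$ continuous on $B$ let $A^{p,s}(B,\psi)$ be the set of all holomorphic functions $F$ on $T_B$ with $$\|F\|_{A^{p,s}(B,\psi)}=\left(\int_B\left(\int_{\mathbb R^n}\left|F(x+iy)e^{-2\pi\psi(y)}\right|^p\,dx\right)^s dy\right)^{\frac1{sp}}<\infty .$$ Let $\Gamma\subset\mathbb R^n$ be a regular open convex cone, that is, a nonempty open set with $0\notin\Gamma$ and $\alpha x+\beta y\in\Gamma$ for all $x,y\in\Gamma$ and $\alpha,\beta>0$, whose dual cone $\Gamma^*=\{t\in\mathbb R^n: t\cdot x\ge 0\text{ for all }x\in\Gamma\}$ has nonempty interior. Let $\psi_1\in C(\Gamma)$ and $\psi_2\in C(-\Gamma)$ satisfy $$\limsup_{y\in\Gamma,\ y\to\infty}\frac{\psi_1(y)}{|y|}<\infty,\qquad \limsup_{y\in\Gamma,\ y\to\infty}\frac{\psi_2(-y)}{|y|}<\infty .$$ Let $1<p\le 2$ and $0<s(p-1)\le 1$, and let $F_1\in A^{p,s}(\Gamma,\psi_1)$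 and $F_2\in A^{p,s}(-\Gamma,\psi_2)$ satisfy $$\liminf_{y\in\Gamma,\ y\to 0}\int_{\mathbb R^n}|F_1(x+iy)-F_2(x-iy)|^p\,dx=0 .$$ Then there is an entire function $F$ on $\mathbb C^n$ with $F=F_1$ on $T_\Gamma$ and $F=F_2$ on $T_{-\Gamma}$. Moreover, there are a bounded convex set $K\subset\mathbb R^n$ and a function $f\in L^1(\mathbb R^n)$ supported in $K$ such that $$F(z)=\int_K f(t)e^{2\pi i t\cdot z}\,dt\qquad\text{for all }z\in\mathbb C^n,$$ where $t\cdot z=t_1z_1+\cdots+t_nz_n$. -/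

import Mathlib

open MeasureTheory Filter Topology
open scoped ENNReal Pointwise

noncomputable section

namespace WeightedBergman

/-- Real Euclidean space of dimension `n`, with Lebesgue measure `volume`. -/
abbrev RSpace (n : ℕ) : Type := EuclideanSpace ℝ (Fin n)

/-- Complex Euclidean space of dimension `n`. -/
abbrev CSpace (n : ℕ) : Type := EuclideanSpace ℂ (Fin n)

/-- The point `x + i y` of complex space, for real vectors `x` and `y`. -/
def cpoint {n : ℕ} (x y : RSpace n) : CSpace n :=
  WithLp.toLp 2 fun k => (x k : ℂ) + Complex.I * (y k : ℂ)

/-- The tube over `B`: the points `x + i y` with `x` an arbitrary real vector and `y ∈ B`. -/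
def tube {n : ℕ} (B : Set (RSpace n)) : Set (CSpace n) :=
  {z | ∃ x : RSpace n, ∃ y ∈ B, z = cpoint x y}

/-- The bilinear pairing `t · z = t₁ z₁ + ⋯ + tₙ zₙ` of a real and a complex vector. -/
def pairing {n : ℕ} (t : RSpace n) (z : CSpace n) : ℂ :=
  ∑ k, (t k : ℂ) * z k

/-- Open convex cones: nonempty open sets that do not contain `0` and are stable under linear
combinations with positive coefficients. -/
structure IsOpenConvexCone {n : ℕ} (Γ : Set (RSpace n)) : Prop where
  isOpen : IsOpen Γ
  nonempty : Γ.Nonempty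
  zero_notMem : (0 : RSpace n) ∉ Γ
  combo_mem : ∀ x ∈ Γ, ∀ y ∈ Γ, ∀ a b : ℝ, 0 < a → 0 < b → a • x + b • y ∈ Γ

/-- Regular open convex cones: the dual cone has nonempty interior. -/
structure IsRegularOpenConvexCone {n : ℕ} (Γ : Set (RSpace n)) : Prop
    extends IsOpenConvexCone Γ where
  regular : (interior (ProperCone.innerDual Γ : Set (RSpace n))).Nonempty

/-- The upper limit of `ψ y / |y|` as `y → ∞` inside `Γ`, as an extended real number. -/
def growthIndex {n : ℕ} (Γ : Set (RSpace n)) (ψ : RSpace n → ℝ) : EReal :=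
  limsup (fun y => ((ψ y / ‖y‖ : ℝ) : EReal)) (Bornology.cobounded (RSpace n) ⊓ 𝓟 Γ)

/-- The weighted mixed norm of `F` over the tube with base `B`, for finite exponents `p` and `s`:
`(∫_B (∫ |F(x+iy) exp(-2πψ(y))|^p dx)^s dy)^(1/(sp))`, with values in `[0,∞]`. -/
def bergmanNorm {n : ℕ} (p s : ℝ) (B : Set (RSpace n)) (ψ : RSpace n → ℝ)
    (F : CSpace n → ℂ) : ℝ≥0∞ :=
  (∫⁻ y in B, (∫⁻ x : RSpace n,
    ‖F (cpoint x y) * (Real.exp (-2 * Real.pi * ψ y) : ℂ)‖ₑ ^ p) ^ s) ^ (1 / (s * p))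

/-- Membership in the weighted Bergman space with finite exponents `p` and `s`: `F` is holomorphic
in the tube over `B` and has finite norm. Values of `F` outside the tube play no role. -/
structure MemBergman {n : ℕ} (p s : ℝ) (B : Set (RSpace n)) (ψ : RSpace n → ℝ)
    (F : CSpace n → ℂ) : Prop where
  holomorphic : DifferentiableOn ℂ F (tube B)
  norm_lt_top : bergmanNorm p s B ψ F < ∞

end WeightedBergman

end

noncomputable section

namespace WeightedBergman

/-! Each `F_j` is the Fourier–Laplace integral of one spectral function `f_j`: formally, the slice
at height `y` is the inverse Fourier transform of `f_j(t) exp(-2π t·y)`. The theorem says that both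
spectral functions coincide and live on a bounded set.

To construct `f_j`, the sub-mean value property of `|F|^r` for every `r > 0` bounds `F` locally in
`y` and uniformly in `x` (`MemBergman.exists_bound`). As `p ≤ 2`, a bounded slice in `L^p` lies in
`L²`, so its Fourier transform is a function. Cauchy's theorem shows that the transforms of
different slices differ only by the exponential factor (`integral_slice_mul_fourier_twist_eq`).

To locate the spectrum, let `C` bound the linear growth of the weight. Near a frequency `t₀` with
`t₀·y < -C|y|` for some `y` in the cone, the factor `exp(2π t·y)` outweighs the growth, on a whole
open subcone of heights. Hausdorff–Young then bounds a fixed power of the pairing of `f_j` with a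
test function by an integrable function on a set of infinite measure, so the pairing is zero
(`MemBergman.integral_mul_fourier_twist_eq_zero`). The cone `Γ` gives `t·y ≥ -C|y|` on the spectrum,
and `-Γ` gives `t·y ≤ C|y|`, for all `y ∈ Γ`.

The liminf hypothesis and Hausdorff–Young, applied to the difference of two slices, give `f₁ = f₂`
almost everywhere (`ae_eq_of_liminf_eq_zero`). The common spectrum lies in `{t : |t·y| ≤ C|y| for y
∈ Γ}`, which is convex, closed, and bounded because `Γ` is open. The Fourier–Laplace integral is
therefore entire. It equals `F_j` on the slices of finite norm by Fourier inversion, and everywhere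
because those slices are dense. -/

/-! ### Sub-mean value property of `|g|^r` on the disc -/

/-- Jensen's inequality for `log |g|` on the unit disc. -/
theorem log_norm_le_circleAverage {g : ℂ → ℂ} (hg : AnalyticOnNhd ℂ g (Metric.closedBall 0 1))
    (h0 : g 0 ≠ 0) :
    Real.log ‖g 0‖ ≤ Real.circleAverage (fun z => Real.log ‖g z‖) 0 1 := by
  have hg' : AnalyticOnNhd ℂ g (Metric.closedBall 0 |(1 : ℝ)|) := by simpa using hg
  rw [AnalyticOnNhd.circleAverage_log_norm one_ne_zero hg' h0]
  refine le_add_of_nonneg_left (finsum_nonneg fun u => ?_)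
  have hd := MeromorphicOn.AnalyticOnNhd.divisor_nonneg hg'
  by_cases hu : u ∈ Metric.closedBall (0 : ℂ) |(1 : ℝ)|
  · refine mul_nonneg (by exact_mod_cast hd u) ?_
    by_cases hu0 : u = 0
    · simp [hu0]
    · apply Real.log_nonneg
      have : ‖u‖ ≤ 1 := by simpa using hu
      rw [zero_sub, norm_neg, one_mul]
      exact (one_le_inv₀ (by positivity)).2 this
  · rw [Function.locallyFinsuppWithin.apply_eq_zero_of_notMem _ hu]; simp

/-- Positive powers of the modulus of a holomorphic function have the sub-mean value property. -/
theorem enorm_rpow_le_lintegral_circle {g : ℂ → ℂ}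
    (hg : AnalyticOnNhd ℂ g (Metric.closedBall 0 1)) {r : ℝ} (hr : 0 < r) :
    ENNReal.ofReal (2 * Real.pi) * ‖g 0‖ₑ ^ r ≤
      ∫⁻ θ in Set.Ioc 0 (2 * Real.pi), ‖g (circleMap 0 1 θ)‖ₑ ^ r := by
  by_cases h0 : g 0 = 0
  · simp [h0, ENNReal.zero_rpow_of_pos hr]
  have hmer : MeromorphicOn g (Metric.sphere 0 |(1 : ℝ)|) :=
    (hg.mono (by simpa using Metric.sphere_subset_closedBall)).meromorphicOn
  have hint : CircleIntegrable (fun z => Real.log ‖g z‖) 0 1 :=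
    hmer.circleIntegrable_log_norm
  have hcont : Continuous fun θ : ℝ => g (circleMap 0 1 θ) := by
    refine hg.continuousOn.comp_continuous (continuous_circleMap 0 1) fun θ => ?_
    simp
  have hpi : 0 < 2 * Real.pi := Real.two_pi_pos
  -- Arc length is normalized to a probability measure so that Jensen's inequality for `exp` applies
  -- to `r log |g|`.
  set μ : Measure ℝ := (ENNReal.ofReal (2 * Real.pi))⁻¹ • volume.restrict (Set.Ioc 0 (2 * Real.pi))
    with hμ
  have hc : ENNReal.ofReal (2 * Real.pi) ≠ 0 := by simpa using hpi
  have : IsProbabilityMeasure μ := ⟨by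
    rw [hμ, Measure.smul_apply, Measure.restrict_apply_univ, Real.volume_Ioc, sub_zero,
      smul_eq_mul, ENNReal.inv_mul_cancel hc ENNReal.ofReal_ne_top]⟩
  have hlog : Real.log ‖g 0‖ ≤ ∫ θ, Real.log ‖g (circleMap 0 1 θ)‖ ∂μ := by
    refine (log_norm_le_circleAverage hg h0).trans (le_of_eq ?_)
    rw [Real.circleAverage, hμ, integral_smul_measure, intervalIntegral.integral_of_le hpi.le,
      ENNReal.toReal_inv, ENNReal.toReal_ofReal hpi.le]
  have hci : Integrable (fun θ => Real.log ‖g (circleMap 0 1 θ)‖) μ := by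
    have := (intervalIntegrable_iff_integrableOn_Ioc_of_le hpi.le).1 hint
    exact this.smul_measure (by simpa using hpi)
  have hpow : Integrable (fun θ => ‖g (circleMap 0 1 θ)‖ ^ r) μ := by
    have h1 : Continuous fun θ => ‖g (circleMap 0 1 θ)‖ ^ r :=
      hcont.norm.rpow_const fun _ => Or.inr hr.le
    exact ((h1.integrableOn_Icc (a := 0) (b := 2 * Real.pi)).mono_set
      Set.Ioc_subset_Icc_self).smul_measure (by simpa using hpi)
  -- Zeros on the circle must be null: there `Real.log 0 = 0`, so `exp (r log |g|)` would be 1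
  -- instead of `|g|^r = 0`.
  have hae : ∀ᵐ θ ∂μ, g (circleMap 0 1 θ) ≠ 0 := by
    have hz : g ⁻¹' {0}ᶜ ∈ codiscreteWithin (Metric.closedBall (0 : ℂ) 1) :=
      hg.preimage_zero_mem_codiscreteWithin h0 (by simp)
        ((convex_closedBall _ _).isConnected ⟨0, by simp⟩)
    have hz' : g ⁻¹' {0}ᶜ ∈ codiscreteWithin (Metric.sphere (0 : ℂ) |(1 : ℝ)|) :=
      codiscreteWithin_mono (by simpa using Metric.sphere_subset_closedBall) hz
    refine Measure.ae_smul_measure ?_ _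
    exact ae_restrict_le_codiscreteWithin measurableSet_Ioc
      (codiscreteWithin_mono (Set.subset_univ _)
        (circleMap_preimage_codiscrete one_ne_zero hz'))
  have hexp : Integrable (fun θ => Real.exp (r * Real.log ‖g (circleMap 0 1 θ)‖)) μ := by
    refine hpow.congr ?_
    filter_upwards [hae] with θ hθ
    rw [Real.rpow_def_of_pos (norm_pos_iff.2 hθ), mul_comm]
  have hJ := convexOn_exp.map_integral_le Real.continuous_exp.continuousOn isClosed_univ
    (by simp) (hci.const_mul r) hexp
  have key : ‖g 0‖ ^ r ≤ ∫ θ, ‖g (circleMap 0 1 θ)‖ ^ r ∂μ := by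
    calc ‖g 0‖ ^ r = Real.exp (r * Real.log ‖g 0‖) := by
          rw [Real.rpow_def_of_pos (norm_pos_iff.2 h0), mul_comm]
      _ ≤ Real.exp (∫ θ, r * Real.log ‖g (circleMap 0 1 θ)‖ ∂μ) := by
          rw [integral_const_mul]; gcongr
      _ ≤ _ := hJ
      _ = _ := by
          refine integral_congr_ae ?_
          filter_upwards [hae] with θ hθ
          rw [Real.rpow_def_of_pos (norm_pos_iff.2 hθ), mul_comm]
  have key' : ‖g 0‖ₑ ^ r ≤ ∫⁻ θ, ‖g (circleMap 0 1 θ)‖ₑ ^ r ∂μ := by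
    have h2 := ENNReal.ofReal_le_ofReal key
    rw [ofReal_integral_eq_lintegral_ofReal hpow (Eventually.of_forall fun _ => by positivity)] at h2
    simpa only [← ENNReal.ofReal_rpow_of_nonneg (norm_nonneg _) hr.le, ofReal_norm] using h2
  rw [hμ, lintegral_smul_measure, smul_eq_mul] at key'
  calc _ ≤ ENNReal.ofReal (2 * Real.pi) * ((ENNReal.ofReal (2 * Real.pi))⁻¹ *
        ∫⁻ θ in Set.Ioc 0 (2 * Real.pi), ‖g (circleMap 0 1 θ)‖ₑ ^ r) := by gcongr
    _ = _ := by
      rw [← mul_assoc, ENNReal.mul_inv_cancel hc ENNReal.ofReal_ne_top, one_mul]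

/-! ### Tubes in real coordinates and sub-mean values over balls -/

variable {n : ℕ}

/-- The imaginary part of a complex vector. -/
def imPart (z : CSpace n) : RSpace n := WithLp.toLp 2 fun k => (z k).im

/-- The real part of a complex vector. -/
def rePart (z : CSpace n) : RSpace n := WithLp.toLp 2 fun k => (z k).re

theorem continuous_imPart : Continuous (imPart (n := n)) := by
  unfold imPart; fun_prop

theorem continuous_cpoint : Continuous fun w : RSpace n × RSpace n => cpoint w.1 w.2 := by
  unfold cpoint; fun_prop

@[simp]
theorem imPart_cpoint (x y : RSpace n) : imPart (cpoint x y) = y := by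
  ext k; simp [imPart, cpoint]

theorem cpoint_rePart_imPart (z : CSpace n) : cpoint (rePart z) (imPart z) = z := by
  ext k
  simp only [cpoint, rePart, imPart]
  rw [mul_comm]; exact Complex.re_add_im _

theorem tube_eq_preimage (B : Set (RSpace n)) : tube B = imPart ⁻¹' B := by
  ext z
  refine ⟨?_, fun h => ⟨rePart z, imPart z, h, (cpoint_rePart_imPart z).symm⟩⟩
  rintro ⟨x, y, hy, rfl⟩
  simpa using hy

@[simp]
theorem cpoint_mem_tube {B : Set (RSpace n)} {x y : RSpace n} : cpoint x y ∈ tube B ↔ y ∈ B := by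
  simp [tube_eq_preimage]

theorem isOpen_tube {B : Set (RSpace n)} (hB : IsOpen B) : IsOpen (tube B) := by
  rw [tube_eq_preimage]; exact hB.preimage continuous_imPart

theorem cpoint_add (x y ξ η : RSpace n) :
    cpoint (x + ξ) (y + η) = cpoint x y + cpoint ξ η := by
  ext k; simp [cpoint]; ring

theorem smul_cpoint (ζ : ℂ) (ξ η : RSpace n) :
    ζ • cpoint ξ η = cpoint (ζ.re • ξ - ζ.im • η) (ζ.im • ξ + ζ.re • η) := by
  ext k
  apply Complex.ext
  · simp [cpoint]
  · simp [cpoint]; ring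

/-- Multiplication of `ξ + i η` by `ζ`, in real coordinates. -/
def rotate (ζ : ℂ) (w : RSpace n × RSpace n) : RSpace n × RSpace n :=
  (ζ.re • w.1 - ζ.im • w.2, ζ.im • w.1 + ζ.re • w.2)

/-- The Euclidean ball of radius `δ` about the origin, in real coordinates. -/
def prodBall (n : ℕ) (δ : ℝ) : Set (RSpace n × RSpace n) :=
  {w | ‖w.1‖ ^ 2 + ‖w.2‖ ^ 2 < δ ^ 2}

theorem isOpen_prodBall (δ : ℝ) : IsOpen (prodBall n δ) :=
  isOpen_lt (by fun_prop) continuous_const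

theorem prodBall_subset {δ : ℝ} (hδ : 0 ≤ δ) :
    prodBall n δ ⊆ Metric.ball 0 δ ×ˢ Metric.ball 0 δ := by
  intro w hw
  have hw : ‖w.1‖ ^ 2 + ‖w.2‖ ^ 2 < δ ^ 2 := hw
  simp only [Set.mem_prod, mem_ball_zero_iff]
  exact ⟨lt_of_pow_lt_pow_left₀ 2 hδ (by nlinarith [sq_nonneg ‖w.2‖]),
    lt_of_pow_lt_pow_left₀ 2 hδ (by nlinarith [sq_nonneg ‖w.1‖])⟩

theorem volume_prodBall_pos {δ : ℝ} (hδ : 0 < δ) : 0 < volume (prodBall n δ) :=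
  (isOpen_prodBall δ).measure_pos _ ⟨0, by simpa [prodBall] using by positivity⟩

theorem volume_prodBall_lt_top {δ : ℝ} (hδ : 0 ≤ δ) : volume (prodBall n δ) < ∞ :=
  ((Metric.isBounded_ball.prod Metric.isBounded_ball).subset (prodBall_subset hδ)).measure_lt_top

theorem norm_sq_rotate (ζ : ℂ) (w : RSpace n × RSpace n) :
    ‖(rotate ζ w).1‖ ^ 2 + ‖(rotate ζ w).2‖ ^ 2 = ‖ζ‖ ^ 2 * (‖w.1‖ ^ 2 + ‖w.2‖ ^ 2) := by
  rw [Complex.sq_norm, Complex.normSq_apply]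
  simp only [rotate, norm_sub_sq_real, norm_add_sq_real, norm_smul, inner_smul_left,
    inner_smul_right, mul_pow, Real.norm_eq_abs, sq_abs]
  simp only [conj_trivial]
  ring

theorem rotate_mem_prodBall_iff {ζ : ℂ} (hζ : ‖ζ‖ = 1) {δ : ℝ} {w : RSpace n × RSpace n} :
    rotate ζ w ∈ prodBall n δ ↔ w ∈ prodBall n δ := by
  simp only [prodBall, Set.mem_ofPred_eq, norm_sq_rotate, hζ, one_pow, one_mul]

theorem rotate_mem_prodBall {ζ : ℂ} (hζ : ‖ζ‖ ≤ 1) {δ : ℝ} {w : RSpace n × RSpace n}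
    (hw : w ∈ prodBall n δ) : rotate ζ w ∈ prodBall n δ := by
  simp only [prodBall, Set.mem_ofPred_eq, norm_sq_rotate] at hw ⊢
  have : ‖ζ‖ ^ 2 ≤ 1 := pow_le_one₀ (norm_nonneg _) hζ
  exact (mul_le_of_le_one_left (by positivity) this).trans_lt hw

instance isAddHaarMeasure_volume_prod :
    (volume : Measure (RSpace n × RSpace n)).IsAddHaarMeasure :=
  inferInstanceAs ((volume : Measure (RSpace n)).prod volume).IsAddHaarMeasure

theorem continuous_rotate :
    Continuous fun u : ℂ × (RSpace n × RSpace n) => rotate u.1 u.2 := by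
  unfold rotate
  have h1 := Complex.continuous_re
  have h2 := Complex.continuous_im
  fun_prop

/-- An injective linear map scales Lebesgue measure by a constant. The unit ball is its own preimage
and has positive finite measure, so the constant is 1. -/
theorem measurePreserving_rotate {ζ : ℂ} (hζ : ‖ζ‖ = 1) :
    MeasurePreserving (rotate (n := n) ζ) volume volume := by
  let L : (RSpace n × RSpace n) →ₗ[ℝ] (RSpace n × RSpace n) :=
    { toFun := rotate ζ
      map_add' := fun v w => by ext k <;> simp [rotate] <;> ring
      map_smul' := fun c w => by ext k <;> simp [rotate] <;> ring }
  have hL : ∀ w, L w = rotate ζ w := fun _ => rfl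
  have hζ' : ζ.re ^ 2 + ζ.im ^ 2 = 1 := by
    have := Complex.sq_norm ζ
    rw [hζ, Complex.normSq_apply] at this
    linarith
  have hdet : LinearMap.det L ≠ 0 := by
    have hinj : Function.Injective L := by
      rw [← LinearMap.ker_eq_bot, LinearMap.ker_eq_bot']
      intro w hw
      rw [hL] at hw
      have h1 : ∀ k, ζ.re * w.1 k - ζ.im * w.2 k = 0 := fun k => by
        simpa [rotate] using congrArg (fun v => v.1 k) hw
      have h2 : ∀ k, ζ.im * w.1 k + ζ.re * w.2 k = 0 := fun k => by
        simpa [rotate] using congrArg (fun v => v.2 k) hw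
      ext k
      · simp only [Prod.fst_zero, PiLp.zero_apply]
        linear_combination ζ.re * h1 k + ζ.im * h2 k - w.1 k * hζ'
      · simp only [Prod.snd_zero, PiLp.zero_apply]
        linear_combination ζ.re * h2 k - ζ.im * h1 k - w.2 k * hζ'
    have := LinearEquiv.isUnit_det' (LinearEquiv.ofInjectiveEndo L hinj)
    exact this.ne_zero
  have hLm : Measurable L := (continuous_rotate.comp (Continuous.prodMk_right ζ)).measurable
  refine ⟨hLm, ?_⟩
  have h1 : Measure.map L (volume : Measure (RSpace n × RSpace n)) = _ :=
    Measure.map_linearMap_addHaar_eq_smul_addHaar volume hdet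
  change Measure.map L volume = volume
  have hpre : L ⁻¹' prodBall n 1 = prodBall n 1 := by
    ext w; exact rotate_mem_prodBall_iff hζ
  have h2 := congrArg (fun μ => μ (prodBall n 1)) h1
  simp only [Measure.smul_apply, smul_eq_mul] at h2
  rw [Measure.map_apply hLm (isOpen_prodBall 1).measurableSet, hpre] at h2
  have h3 : ENNReal.ofReal |(LinearMap.det L)⁻¹| = 1 := by
    have h0 := (volume_prodBall_pos (n := n) one_pos).ne'
    have ht := (volume_prodBall_lt_top (n := n) zero_le_one).ne
    rw [← ENNReal.mul_left_inj h0 ht, one_mul, ← h2]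
  rw [h1, h3, one_smul]

/-- The sub-mean value property of `|F| ^ r` for `F` holomorphic in a tube. -/
theorem volume_prodBall_mul_enorm_rpow_le {B : Set (RSpace n)} {F : CSpace n → ℂ}
    (hB : IsOpen B) (hF : DifferentiableOn ℂ F (tube B)) {r : ℝ} (hr : 0 < r) {δ : ℝ} (hδ : 0 ≤ δ)
    (x : RSpace n) {y : RSpace n} (hy : Metric.ball y δ ⊆ B) :
    volume (prodBall n δ) * ‖F (cpoint x y)‖ₑ ^ r ≤
      ∫⁻ w in prodBall n δ, ‖F (cpoint (x + w.1) (y + w.2))‖ₑ ^ r := by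
  set P := prodBall n δ
  have hPm : MeasurableSet P := (isOpen_prodBall δ).measurableSet
  have htube : ∀ w ∈ P, cpoint (x + w.1) (y + w.2) ∈ tube B := fun w hw => by
    rw [cpoint_mem_tube]
    exact hy (by simpa using (prodBall_subset hδ hw).2)
  set G : RSpace n × RSpace n → ℝ≥0∞ :=
    P.indicator fun w => ‖F (cpoint (x + w.1) (y + w.2))‖ₑ ^ r with hG
  have hGm : Measurable G := by
    have hc : ContinuousOn (fun w : RSpace n × RSpace n => F (cpoint (x + w.1) (y + w.2))) P :=
      hF.continuousOn.comp (continuous_cpoint.comp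
        (f := fun w : RSpace n × RSpace n => (x + w.1, y + w.2)) (by fun_prop)).continuousOn htube
    classical
    rw [hG, ← Set.piecewise_eq_indicator]
    exact ContinuousOn.measurable_piecewise
      (ENNReal.continuous_rpow_const.comp_continuousOn hc.enorm) continuousOn_const hPm
  -- The one-variable inequality is used on the complex line through `x + iy` in the direction `w`.
  -- After integration over `w`, invariance of the ball and of its measure under rotation removes
  -- `θ`.
  have hpt : ∀ w ∈ P, ENNReal.ofReal (2 * Real.pi) * ‖F (cpoint x y)‖ₑ ^ r ≤
      ∫⁻ θ in Set.Ioc 0 (2 * Real.pi), G (rotate (circleMap 0 1 θ) w) := by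
    intro w hw
    set g : ℂ → ℂ := fun ζ => F (cpoint x y + ζ • cpoint w.1 w.2)
    have hgan : AnalyticOnNhd ℂ g (Metric.closedBall 0 1) := by
      have hopen : IsOpen {ζ : ℂ | cpoint x y + ζ • cpoint w.1 w.2 ∈ tube B} :=
        (isOpen_tube hB).preimage (by fun_prop)
      have hd : DifferentiableOn ℂ g {ζ : ℂ | cpoint x y + ζ • cpoint w.1 w.2 ∈ tube B} :=
        hF.comp (by fun_prop) fun ζ hζ => hζ
      refine (hd.analyticOnNhd hopen).mono fun ζ hζ => ?_
      have hζ : ‖ζ‖ ≤ 1 := by simpa using hζ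
      rw [Set.mem_ofPred_eq, smul_cpoint, ← cpoint_add, cpoint_mem_tube]
      have hrot := htube (rotate ζ w) (rotate_mem_prodBall hζ hw)
      rw [cpoint_mem_tube] at hrot
      simpa only [rotate] using hrot
    have h := enorm_rpow_le_lintegral_circle hgan hr
    simp only [g, zero_smul, add_zero] at h
    refine h.trans (le_of_eq (lintegral_congr fun θ => ?_))
    have hmem : rotate (circleMap 0 1 θ) w ∈ P :=
      rotate_mem_prodBall (norm_circleMap_zero 1 θ ▸ abs_one.le) hw
    rw [hG, Set.indicator_of_mem hmem, smul_cpoint, ← cpoint_add]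
    simp only [rotate]
  have hpi : ENNReal.ofReal (2 * Real.pi) ≠ 0 := by simpa using Real.pi_pos
  rw [← ENNReal.mul_le_mul_iff_right hpi ENNReal.ofReal_ne_top]
  calc ENNReal.ofReal (2 * Real.pi) * (volume P * ‖F (cpoint x y)‖ₑ ^ r)
      = ∫⁻ w in P, ENNReal.ofReal (2 * Real.pi) * ‖F (cpoint x y)‖ₑ ^ r := by
        rw [lintegral_const, Measure.restrict_apply_univ]; ring
    _ ≤ ∫⁻ w in P, ∫⁻ θ in Set.Ioc 0 (2 * Real.pi), G (rotate (circleMap 0 1 θ) w) :=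
        setLIntegral_mono' hPm hpt
    _ ≤ ∫⁻ w, ∫⁻ θ in Set.Ioc 0 (2 * Real.pi), G (rotate (circleMap 0 1 θ) w) :=
        setLIntegral_le_lintegral _ _
    _ = ∫⁻ θ in Set.Ioc 0 (2 * Real.pi), ∫⁻ w, G (rotate (circleMap 0 1 θ) w) := by
        refine lintegral_lintegral_swap (Measurable.aemeasurable ?_)
        refine hGm.comp (Continuous.measurable ?_)
        exact continuous_rotate.comp (f := fun u : (RSpace n × RSpace n) × ℝ =>
          (circleMap 0 1 u.2, u.1)) (by fun_prop)
    _ = ∫⁻ θ in Set.Ioc 0 (2 * Real.pi), ∫⁻ w, G w :=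
        lintegral_congr fun θ =>
          (measurePreserving_rotate (norm_circleMap_zero 1 θ ▸ abs_one)).lintegral_comp hGm
    _ = _ := by
        rw [lintegral_const, Measure.restrict_apply_univ, Real.volume_Ioc, sub_zero, mul_comm,
          hG, lintegral_indicator hPm]

/-! ### Slice norms and local boundedness -/

/-- The `p`-th power of the `L^p` norm of `F` on the slice `ℝⁿ + i y`. -/
def sliceNorm (p : ℝ) (F : CSpace n → ℂ) (y : RSpace n) : ℝ≥0∞ :=
  ∫⁻ x : RSpace n, ‖F (cpoint x y)‖ₑ ^ p

theorem lintegral_weighted_rpow {p s : ℝ} (hp : 0 < p) (hs : 0 < s) (F : CSpace n → ℂ)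
    (y : RSpace n) (c : ℝ) :
    (∫⁻ x : RSpace n, ‖F (cpoint x y) * (Real.exp (-2 * Real.pi * c) : ℂ)‖ₑ ^ p) ^ s =
      sliceNorm p F y ^ s * ENNReal.ofReal (Real.exp (-2 * Real.pi * p * s * c)) := by
  have h1 : ∀ x : RSpace n, ‖F (cpoint x y) * (Real.exp (-2 * Real.pi * c) : ℂ)‖ₑ ^ p =
      ‖F (cpoint x y)‖ₑ ^ p * ENNReal.ofReal (Real.exp (-2 * Real.pi * c)) ^ p := fun x => by
    rw [enorm_mul, ENNReal.mul_rpow_of_nonneg _ _ hp.le, ← ofReal_norm (Complex.ofReal _),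
      Complex.norm_real, Real.norm_eq_abs, abs_of_pos (Real.exp_pos _)]
  simp_rw [h1]
  rw [lintegral_mul_const' _ _ (ENNReal.rpow_ne_top_of_nonneg hp.le ENNReal.ofReal_ne_top),
    ENNReal.mul_rpow_of_nonneg _ _ hs.le, sliceNorm, ← ENNReal.rpow_mul,
    ENNReal.ofReal_rpow_of_pos (Real.exp_pos _), ← Real.exp_mul]
  ring_nf

theorem MemBergman.lintegral_lt_top {p s : ℝ} (hp : 0 < p) (hs : 0 < s) {B : Set (RSpace n)}
    (hB : IsOpen B) {ψ : RSpace n → ℝ} {F : CSpace n → ℂ} (hF : MemBergman p s B ψ F) :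
    ∫⁻ y in B, sliceNorm p F y ^ s * ENNReal.ofReal (Real.exp (-2 * Real.pi * p * s * ψ y)) < ∞ := by
  have h := hF.norm_lt_top
  rw [bergmanNorm, ENNReal.rpow_lt_top_iff_of_pos (by positivity)] at h
  refine lt_of_eq_of_lt (setLIntegral_congr_fun hB.measurableSet fun y _ => ?_) h
  exact (lintegral_weighted_rpow hp hs F y (ψ y)).symm

/-- The slice norms of a function of a weighted Bergman space are locally `s`-integrable. -/
theorem MemBergman.exists_lintegral_ball_lt_top {p s : ℝ} (hp : 0 < p) (hs : 0 < s)
    {B : Set (RSpace n)} (hB : IsOpen B) {ψ : RSpace n → ℝ} (hψ : ContinuousOn ψ B)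
    {F : CSpace n → ℂ} (hF : MemBergman p s B ψ F) {y : RSpace n} (hy : y ∈ B) :
    ∃ δ > 0, Metric.ball y δ ⊆ B ∧ ∫⁻ η in Metric.ball y δ, sliceNorm p F η ^ s < ∞ := by
  have hev : ∀ᶠ η in 𝓝 y, η ∈ B ∧ ψ η < ψ y + 1 :=
    (show ∀ᶠ η in 𝓝 y, η ∈ B from hB.mem_nhds hy).and ((hψ.continuousAt (hB.mem_nhds hy)).eventually_lt
      continuousAt_const (by simp))
  obtain ⟨δ, hδ, h⟩ := Metric.eventually_nhds_iff_ball.1 hev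
  refine ⟨δ, hδ, fun η hη => (h η hη).1, ?_⟩
  -- On the ball `ψ < ψ y + 1`, so `c` times the weight is at least 1 there.
  set c := ENNReal.ofReal (Real.exp (2 * Real.pi * p * s * (ψ y + 1)))
  calc ∫⁻ η in Metric.ball y δ, sliceNorm p F η ^ s
      ≤ ∫⁻ η in Metric.ball y δ, c * (sliceNorm p F η ^ s *
          ENNReal.ofReal (Real.exp (-2 * Real.pi * p * s * ψ η))) := by
        refine setLIntegral_mono' Metric.isOpen_ball.measurableSet fun η hη => ?_
        have h1 : 1 ≤ c * ENNReal.ofReal (Real.exp (-2 * Real.pi * p * s * ψ η)) := by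
          rw [← ENNReal.ofReal_mul (Real.exp_pos _).le, ← Real.exp_add, ENNReal.one_le_ofReal]
          apply Real.one_le_exp
          have := mul_pos (mul_pos (mul_pos two_pos Real.pi_pos) hp) hs
          nlinarith [(h η hη).2]
        calc sliceNorm p F η ^ s ≤ sliceNorm p F η ^ s *
              (c * ENNReal.ofReal (Real.exp (-2 * Real.pi * p * s * ψ η))) :=
              le_mul_of_one_le_right zero_le h1
          _ = _ := by ring
    _ = c * ∫⁻ η in Metric.ball y δ, (sliceNorm p F η ^ s *
          ENNReal.ofReal (Real.exp (-2 * Real.pi * p * s * ψ η))) :=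
        lintegral_const_mul' _ _ ENNReal.ofReal_ne_top
    _ < ∞ := by
        refine ENNReal.mul_lt_top ENNReal.ofReal_lt_top
          ((lintegral_mono_set fun η hη => (h η hη).1).trans_lt (hF.lintegral_lt_top hp hs hB))

/-- Slices of finite norm are dense. -/
theorem MemBergman.exists_sliceNorm_lt_top {p s : ℝ} (hp : 0 < p) (hs : 0 < s)
    {B : Set (RSpace n)} (hB : IsOpen B) {ψ : RSpace n → ℝ} (hψ : ContinuousOn ψ B)
    {F : CSpace n → ℂ} (hF : MemBergman p s B ψ F) {y : RSpace n} (hy : y ∈ B)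
    {ε : ℝ} (hε : 0 < ε) : ∃ η ∈ B, dist η y < ε ∧ sliceNorm p F η < ∞ := by
  obtain ⟨δ, hδ, hsub, hint⟩ := hF.exists_lintegral_ball_lt_top hp hs hB hψ hy
  by_contra! hcon
  have hsub' : Metric.ball y (min δ ε) ⊆ Metric.ball y δ := Metric.ball_subset_ball (min_le_left _ _)
  have htop : ∫⁻ η in Metric.ball y (min δ ε), sliceNorm p F η ^ s = ∞ := by
    rw [setLIntegral_congr_fun (g := fun _ => ∞) Metric.isOpen_ball.measurableSet]
    · rw [lintegral_const, Measure.restrict_apply_univ, ENNReal.top_mul]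
      exact (Metric.measure_ball_pos _ _ (lt_min hδ hε)).ne'
    · intro η hη
      have h1 := hcon η (hsub (hsub' hη)) ((Metric.mem_ball.1 hη).trans_le (min_le_right _ _))
      simp only [top_le_iff.1 h1, ENNReal.top_rpow_of_pos hs]
  exact absurd (htop ▸ (lintegral_mono_set hsub').trans_lt hint) (lt_irrefl _)

/-- Hölder's inequality against the constant 1, with weights `s` and `1 - s`; the ball is then
enlarged to the whole space. -/
theorem lintegral_ball_rpow_le {p s : ℝ} (hs0 : 0 ≤ s) (hs1 : s ≤ 1) {F : CSpace n → ℂ}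
    {x y : RSpace n} {δ : ℝ} (hF : AEMeasurable (fun ξ => ‖F (cpoint (x + ξ) y)‖ₑ ^ p)) :
    ∫⁻ ξ in Metric.ball (0 : RSpace n) δ, ‖F (cpoint (x + ξ) y)‖ₑ ^ (p * s) ≤
      sliceNorm p F y ^ s * volume (Metric.ball (0 : RSpace n) δ) ^ (1 - s) := by
  have h := ENNReal.lintegral_mul_norm_pow_le
    (μ := volume.restrict (Metric.ball (0 : RSpace n) δ)) (g := fun _ => 1)
    hF.restrict aemeasurable_const hs0 (sub_nonneg.2 hs1) (by ring)
  simp only [ENNReal.one_rpow, mul_one, lintegral_one, Measure.restrict_apply_univ,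
    ← ENNReal.rpow_mul] at h
  refine h.trans ?_
  gcongr
  refine (setLIntegral_le_lintegral _ _).trans (le_of_eq ?_)
  exact lintegral_add_left_eq_self (fun ξ => ‖F (cpoint ξ y)‖ₑ ^ p) x

/-- Functions of weighted Bergman spaces are locally bounded, uniformly in the real directions. -/
theorem MemBergman.exists_bound {p s : ℝ} (hp : 0 < p) (hs : 0 < s)
    {B : Set (RSpace n)} (hB : IsOpen B) {ψ : RSpace n → ℝ} (hψ : ContinuousOn ψ B)
    {F : CSpace n → ℂ} (hF : MemBergman p s B ψ F) {y : RSpace n} (hy : y ∈ B) :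
    ∃ δ > 0, ∃ A : ℝ, ∀ η ∈ Metric.ball y δ, ∀ x, ‖F (cpoint x η)‖ ≤ A := by
  obtain ⟨δ₀, hδ₀, hsub, hint⟩ := hF.exists_lintegral_ball_lt_top hp hs hB hψ hy
  set δ := δ₀ / 2 with hδdef
  have hδ : 0 < δ := by positivity
  -- Hölder on balls needs an exponent at most 1, and comparison with the given integral needs one
  -- at most `s`. The resulting power `p * σ` may be below 1, hence the sub-mean value property for
  -- all positive powers.
  set σ := min s 1
  have hσ : 0 < σ := lt_min hs one_pos
  have hr : 0 < p * σ := mul_pos hp hσ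
  set b : Set (RSpace n) := Metric.ball 0 δ
  have hb : volume b < ∞ := Metric.isBounded_ball.measure_lt_top
  set C : ℝ≥0∞ := volume b ^ (1 - σ) *
    (volume b + ∫⁻ η in Metric.ball y δ₀, sliceNorm p F η ^ s)
  have hC : C < ∞ := ENNReal.mul_lt_top
    (ENNReal.rpow_lt_top_of_nonneg (sub_nonneg.2 (min_le_right _ _)) hb.ne)
    (ENNReal.add_lt_top.2 ⟨hb, hint⟩)
  have hv0 := (volume_prodBall_pos (n := n) hδ).ne'
  have hvt := (volume_prodBall_lt_top (n := n) hδ.le).ne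
  have key : ∀ η ∈ Metric.ball y δ, ∀ x,
      volume (prodBall n δ) * ‖F (cpoint x η)‖ₑ ^ (p * σ) ≤ C := by
    intro η hη x
    have hball : Metric.ball η δ ⊆ Metric.ball y δ₀ :=
      Metric.ball_subset_ball' (by rw [Metric.mem_ball] at hη; rw [hδdef] at hη ⊢; linarith)
    have hmem : ∀ v ∈ b, η + v ∈ B := fun v hv =>
      hsub (hball (by simpa [b] using hv))
    have hcont : ContinuousOn (fun w : RSpace n × RSpace n =>
        ‖F (cpoint (x + w.1) (η + w.2))‖ₑ ^ (p * σ)) (b ×ˢ b) := by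
      refine ENNReal.continuous_rpow_const.comp_continuousOn (ContinuousOn.enorm ?_)
      refine hF.holomorphic.continuousOn.comp (continuous_cpoint.comp
        (f := fun w : RSpace n × RSpace n => (x + w.1, η + w.2)) (by fun_prop)).continuousOn ?_
      intro w hw
      exact cpoint_mem_tube.2 (hmem _ hw.2)
    have hbm : MeasurableSet b := Metric.isOpen_ball.measurableSet
    calc volume (prodBall n δ) * ‖F (cpoint x η)‖ₑ ^ (p * σ)
        ≤ ∫⁻ w in prodBall n δ, ‖F (cpoint (x + w.1) (η + w.2))‖ₑ ^ (p * σ) :=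
          volume_prodBall_mul_enorm_rpow_le hB hF.holomorphic hr hδ.le x (hball.trans hsub)
      _ ≤ ∫⁻ w in b ×ˢ b, ‖F (cpoint (x + w.1) (η + w.2))‖ₑ ^ (p * σ) :=
          lintegral_mono_set (prodBall_subset hδ.le)
      _ = ∫⁻ v in b, ∫⁻ ξ in b, ‖F (cpoint (x + ξ) (η + v))‖ₑ ^ (p * σ) := by
          have hm := hcont.aemeasurable (μ := volume) (hbm.prod hbm)
          rw [Measure.volume_eq_prod, ← Measure.prod_restrict] at hm ⊢
          exact lintegral_prod_symm _ hm
      _ ≤ ∫⁻ v in b, volume b ^ (1 - σ) * (1 + sliceNorm p F (η + v) ^ s) := by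
          refine setLIntegral_mono' hbm fun v hv => ?_
          have hme : Continuous fun ξ : RSpace n => F (cpoint (x + ξ) (η + v)) :=
            hF.holomorphic.continuousOn.comp_continuous (continuous_cpoint.comp
              (f := fun ξ : RSpace n => (x + ξ, η + v)) (by fun_prop))
              fun ξ => cpoint_mem_tube.2 (hmem v hv)
          refine (lintegral_ball_rpow_le hσ.le (min_le_right _ _)
            (ENNReal.continuous_rpow_const.comp hme.enorm).measurable.aemeasurable).trans ?_
          rw [mul_comm]
          gcongr
          -- `N^σ ≤ 1 + N^s`, since `0 < σ ≤ s`.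
          rcases le_total (sliceNorm p F (η + v)) 1 with h1 | h1
          · exact (ENNReal.rpow_le_one h1 hσ.le).trans le_self_add
          · exact (ENNReal.rpow_le_rpow_of_exponent_le h1 (min_le_left _ _)).trans le_add_self
      _ = volume b ^ (1 - σ) * (volume b + ∫⁻ v in b, sliceNorm p F (η + v) ^ s) := by
          rw [lintegral_const_mul' _ _ (ENNReal.rpow_lt_top_of_nonneg
            (sub_nonneg.2 (min_le_right _ _)) hb.ne).ne, lintegral_add_left measurable_const,
            lintegral_const, Measure.restrict_apply_univ, one_mul]
      _ ≤ C := by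
          change _ ≤ volume b ^ (1 - σ) *
            (volume b + ∫⁻ η in Metric.ball y δ₀, sliceNorm p F η ^ s)
          refine mul_le_mul' le_rfl (add_le_add le_rfl
            (le_trans (le_of_eq ?_) (lintegral_mono_set hball)))
          rw [← lintegral_indicator hbm, ← lintegral_indicator Metric.isOpen_ball.measurableSet,
            ← lintegral_add_left_eq_self ((Metric.ball η δ).indicator _) η]
          refine lintegral_congr fun v => ?_
          by_cases hv : v ∈ b
          · rw [Set.indicator_of_mem hv, Set.indicator_of_mem (by simpa [b] using hv)]
          · rw [Set.indicator_of_notMem hv, Set.indicator_of_notMem (by simpa [b] using hv)]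
  refine ⟨δ, hδ, ((C / volume (prodBall n δ)) ^ (p * σ)⁻¹).toReal, fun η hη x => ?_⟩
  have h1 : ‖F (cpoint x η)‖ₑ ^ (p * σ) ≤ C / volume (prodBall n δ) := by
    rw [ENNReal.le_div_iff_mul_le (Or.inl hv0) (Or.inl hvt), mul_comm]
    exact key η hη x
  have h2 : ‖F (cpoint x η)‖ₑ ≤ (C / volume (prodBall n δ)) ^ (p * σ)⁻¹ :=
    (ENNReal.le_rpow_inv_iff hr).2 h1
  have h3 : (C / volume (prodBall n δ)) ^ (p * σ)⁻¹ ≠ ∞ :=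
    ENNReal.rpow_ne_top_of_nonneg (by positivity) (ENNReal.div_lt_top hC.ne hv0).ne
  rw [← toReal_enorm]
  exact ENNReal.toReal_mono h3 h2

/-! ### Contour shift and independence of the slice -/

/-- Contour shift: the integral of a holomorphic function over a horizontal slice of a tube does
not depend on the slice. -/
theorem integral_slice_eq_of_bound {B : Set (RSpace n)} {H : CSpace n → ℂ}
    (hH : DifferentiableOn ℂ H (tube B)) {y₀ y₁ : RSpace n} (hseg : segment ℝ y₀ y₁ ⊆ B)
    {b : RSpace n → ℝ} (hb : Integrable b)
    (hbd : ∀ η ∈ segment ℝ y₀ y₁, ∀ x, ‖H (cpoint x η)‖ ≤ b x) :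
    ∫ x, H (cpoint x y₀) = ∫ x, H (cpoint x y₁) := by
  set v := y₁ - y₀ with hv
  have hmem : ∀ τ ∈ Set.Icc (0 : ℝ) 1, y₀ + τ • v ∈ segment ℝ y₀ y₁ := fun τ hτ => by
    rw [segment_eq_image']; exact ⟨τ, hτ, rfl⟩
  have hpt : ∀ (x : RSpace n) (ζ : ℂ),
      cpoint x y₀ + ζ • cpoint v 0 = cpoint (x + ζ.re • v) (y₀ + ζ.im • v) := fun x ζ => by
    rw [smul_cpoint, ← cpoint_add]; simp
  have hcont : ∀ η ∈ B, Continuous fun x => H (cpoint x η) := fun η hη =>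
    hH.continuousOn.comp_continuous (continuous_cpoint.comp
      (f := fun x : RSpace n => (x, η)) (by fun_prop)) fun x => cpoint_mem_tube.2 hη
  have h0 : y₀ ∈ segment ℝ y₀ y₁ := left_mem_segment _ _ _
  have h1 : y₁ ∈ segment ℝ y₀ y₁ := right_mem_segment _ _ _
  have hint : ∀ η ∈ segment ℝ y₀ y₁, Integrable fun x => H (cpoint x η) := fun η hη =>
    hb.mono' (hcont η (hseg hη)).aestronglyMeasurable (Eventually.of_forall (hbd η hη))
  -- Cauchy's theorem on the unit square for `ζ ↦ H(x + iy₀ + ζv)`. After integration in `x`, each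
  -- horizontal edge becomes a full slice integral, and the two vertical edges, translates of each
  -- other by `v`, cancel. No limit at infinity is needed.
  have hrect : ∀ x, (∫ σ in (0 : ℝ)..1, H (cpoint (x + σ • v) y₀)) -
      (∫ σ in (0 : ℝ)..1, H (cpoint (x + σ • v) y₁)) +
      Complex.I • (∫ τ in (0 : ℝ)..1, H (cpoint (x + v) (y₀ + τ • v))) -
      Complex.I • (∫ τ in (0 : ℝ)..1, H (cpoint x (y₀ + τ • v))) = 0 := by
    intro x
    have h := Complex.integral_boundary_rect_eq_zero_of_differentiableOn
      (fun ζ => H (cpoint x y₀ + ζ • cpoint v 0)) 0 (1 + Complex.I) (by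
        refine hH.comp (by fun_prop) fun ζ hζ => ?_
        rw [hpt, cpoint_mem_tube]
        refine hseg (hmem _ ?_)
        have := (Complex.mem_reProdIm.1 hζ).2
        simpa using this)
    simp only [hpt] at h
    simpa [hv] using h
  have hhor : ∀ η ∈ segment ℝ y₀ y₁,
      Integrable (fun x => ∫ σ in (0 : ℝ)..1, H (cpoint (x + σ • v) η)) ∧
      ∫ x, ∫ σ in (0 : ℝ)..1, H (cpoint (x + σ • v) η) = ∫ x, H (cpoint x η) := by
    intro η hη
    have hprod : Integrable (fun u : RSpace n × ℝ => H (cpoint (u.1 + u.2 • v) η))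
        (volume.prod (volume.restrict (Set.Ioc 0 1))) := by
      refine (integrable_prod_iff' ?_).2 ⟨Eventually.of_forall fun σ => ?_, ?_⟩
      · exact ((hcont η (hseg hη)).comp (f := fun u : RSpace n × ℝ => u.1 + u.2 • v)
          (by fun_prop)).aestronglyMeasurable
      · exact (hint η hη).comp_add_right (σ • v)
      · simp only [integral_add_right_eq_self fun x => ‖H (cpoint x η)‖]
        exact integrable_const _
    simp only [intervalIntegral.integral_of_le zero_le_one]
    refine ⟨hprod.integral_prod_left, ?_⟩
    rw [integral_integral_swap hprod]
    simp only [integral_add_right_eq_self fun x => H (cpoint x η)]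
    simp
  have hver : Integrable fun x => ∫ τ in (0 : ℝ)..1, H (cpoint x (y₀ + τ • v)) := by
    have hprod : Integrable (fun u : RSpace n × ℝ => H (cpoint u.1 (y₀ + u.2 • v)))
        (volume.prod (volume.restrict (Set.Icc 0 1))) := by
      have hbp : Integrable (fun u : RSpace n × ℝ => b u.1)
          (volume.prod (volume.restrict (Set.Icc (0 : ℝ) 1))) := hb.comp_fst _
      have hae : ∀ᵐ u : RSpace n × ℝ ∂(volume.prod (volume.restrict (Set.Icc 0 1))),
          u ∈ Set.univ ×ˢ Set.Icc (0 : ℝ) 1 := by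
        rw [← Measure.restrict_univ (μ := (volume : Measure (RSpace n))), Measure.prod_restrict]
        exact ae_restrict_mem (MeasurableSet.univ.prod measurableSet_Icc)
      refine hbp.mono' ?_ ?_
      · rw [← Measure.restrict_univ (μ := (volume : Measure (RSpace n))), Measure.prod_restrict]
        refine ContinuousOn.aestronglyMeasurable ?_ (MeasurableSet.univ.prod measurableSet_Icc)
        refine hH.continuousOn.comp (continuous_cpoint.comp
          (f := fun u : RSpace n × ℝ => (u.1, y₀ + u.2 • v)) (by fun_prop)).continuousOn ?_
        exact fun u hu => cpoint_mem_tube.2 (hseg (hmem _ hu.2))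
      · filter_upwards [hae] with u hu
        exact hbd _ (hmem _ hu.2) _
    simp only [intervalIntegral.integral_of_le zero_le_one, ← integral_Icc_eq_integral_Ioc]
    exact hprod.integral_prod_left
  have hver' := hver.comp_add_right v
  have hlin : ∀ {f g h k : RSpace n → ℂ}, Integrable f → Integrable g → Integrable h →
      Integrable k → ∫ x, (f x - g x + Complex.I • h x - Complex.I • k x) =
        (∫ x, f x) - (∫ x, g x) + Complex.I • (∫ x, h x) - Complex.I • ∫ x, k x := by
    intro f g h k hf hg hh hk
    have e₁ : Integrable fun x => f x - g x := hf.sub hg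
    have e₂ : Integrable fun x => Complex.I • h x := hh.smul Complex.I
    have e₃ : Integrable fun x => Complex.I • k x := hk.smul Complex.I
    have e₄ : Integrable fun x => f x - g x + Complex.I • h x := e₁.add e₂
    rw [integral_sub e₄ e₃, integral_add e₁ e₂, integral_sub hf hg, integral_smul,
      integral_smul]
  have hsum := hlin (hhor y₀ h0).1 (hhor y₁ h1).1 hver' hver
  rw [integral_congr_ae (Eventually.of_forall hrect), integral_zero, (hhor y₀ h0).2,
    (hhor y₁ h1).2,
    integral_add_right_eq_self fun x => ∫ τ in (0 : ℝ)..1, H (cpoint x (y₀ + τ • v)),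
    add_sub_cancel_right] at hsum
  exact sub_eq_zero.1 hsum.symm

open scoped FourierTransform RealInnerProductSpace ContDiff

theorem pairing_cpoint (t x y : RSpace n) :
    pairing t (cpoint x y) = (⟪t, x⟫ : ℝ) + Complex.I * (⟪t, y⟫ : ℝ) := by
  simp only [pairing, cpoint, PiLp.inner_apply, RCLike.inner_apply, conj_trivial,
    Complex.ofReal_sum, Finset.mul_sum, ← Finset.sum_add_distrib]
  refine Finset.sum_congr rfl fun k _ => ?_
  push_cast
  ring

theorem sum_sq_cpoint (x y : RSpace n) :
    ∑ k, cpoint x y k ^ 2 = ((‖x‖ ^ 2 - ‖y‖ ^ 2 : ℝ) : ℂ) + 2 * Complex.I * (⟪x, y⟫ : ℝ) := by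
  simp only [cpoint, PiLp.inner_apply, RCLike.inner_apply, conj_trivial,
    EuclideanSpace.real_norm_sq_eq, Complex.ofReal_sum, Finset.mul_sum, Complex.ofReal_sub,
    ← Finset.sum_add_distrib, ← Finset.sum_sub_distrib]
  refine Finset.sum_congr rfl fun k _ => ?_
  push_cast
  linear_combination (y k : ℂ) ^ 2 * Complex.I_sq

/-- The entire function `exp (-ε z · z)`. -/
def gauss (ε : ℝ) (z : CSpace n) : ℂ := Complex.exp (-ε * ∑ k, z k ^ 2)

theorem differentiable_gauss (ε : ℝ) : Differentiable ℂ (gauss (n := n) ε) := by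
  unfold gauss; fun_prop

theorem differentiable_pairing (t : RSpace n) : Differentiable ℂ (pairing t) := by
  unfold pairing; fun_prop

theorem norm_gauss_cpoint (ε : ℝ) (x y : RSpace n) :
    ‖gauss ε (cpoint x y)‖ = Real.exp (-ε * ‖x‖ ^ 2) * Real.exp (ε * ‖y‖ ^ 2) := by
  rw [gauss, Complex.norm_exp, sum_sq_cpoint, ← Real.exp_add]
  congr 1
  simp [-Complex.ofReal_sub, -Complex.ofReal_pow]
  ring

theorem norm_exp_pairing (t x y : RSpace n) :
    ‖Complex.exp (-2 * Real.pi * Complex.I * pairing t (cpoint x y))‖ =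
      Real.exp (2 * Real.pi * ⟪t, y⟫) := by
  rw [Complex.norm_exp, pairing_cpoint]
  congr 1
  simp

theorem integrable_exp_neg_mul_norm_sq {ε : ℝ} (hε : 0 < ε) :
    Integrable fun x : RSpace n => Real.exp (-ε * ‖x‖ ^ 2) := by
  have h := GaussianFourier.integrable_cexp_neg_mul_sq_norm_add (V := RSpace n) (b := (ε : ℂ))
    (by simpa using hε) 0 0
  refine h.norm.congr (Eventually.of_forall fun x => ?_)
  simp only [Complex.norm_exp, inner_zero_left, Complex.ofReal_zero, mul_zero, add_zero]
  rw [← Complex.ofReal_neg, ← Complex.ofReal_pow, ← Complex.ofReal_mul, Complex.ofReal_re]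

/-- Locally in the base, `F` is bounded on the tube over `B`. -/
def LocallyBoundedOnTube (B : Set (RSpace n)) (F : CSpace n → ℂ) : Prop :=
  ∀ y ∈ B, ∃ δ > 0, ∃ A : ℝ, ∀ η ∈ Metric.ball y δ, ∀ x, ‖F (cpoint x η)‖ ≤ A

theorem LocallyBoundedOnTube.exists_bound_compact {B K : Set (RSpace n)} {F : CSpace n → ℂ}
    (hF : LocallyBoundedOnTube B F) (hK : IsCompact K) (hKB : K ⊆ B) :
    ∃ A : ℝ, ∀ η ∈ K, ∀ x, ‖F (cpoint x η)‖ ≤ A := by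
  refine hK.induction_on (p := fun S => ∃ A : ℝ, ∀ η ∈ S, ∀ x, ‖F (cpoint x η)‖ ≤ A)
    ⟨0, by simp⟩ ?_ ?_ ?_
  · rintro S T hST ⟨A, hA⟩
    exact ⟨A, fun η hη => hA η (hST hη)⟩
  · rintro S T ⟨A, hA⟩ ⟨A', hA'⟩
    refine ⟨max A A', fun η hη x => ?_⟩
    rcases hη with hη | hη
    · exact (hA η hη x).trans (le_max_left _ _)
    · exact (hA' η hη x).trans (le_max_right _ _)
  · intro y hy
    obtain ⟨δ, hδ, A, hA⟩ := hF y (hKB hy)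
    exact ⟨Metric.ball y δ, mem_nhdsWithin_of_mem_nhds (Metric.ball_mem_nhds y hδ), A, hA⟩

/-- Contour shift for the Fourier integral, with Gaussian regularization. -/
theorem integral_gauss_exp_eq {B : Set (RSpace n)} (hB : Convex ℝ B) {F : CSpace n → ℂ}
    (hF : DifferentiableOn ℂ F (tube B)) (hbd : LocallyBoundedOnTube B F) {ε : ℝ} (hε : 0 < ε)
    (t : RSpace n) {y₀ y₁ : RSpace n} (h₀ : y₀ ∈ B) (h₁ : y₁ ∈ B) :
    ∫ x, F (cpoint x y₀) * gauss ε (cpoint x y₀) *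
        Complex.exp (-2 * Real.pi * Complex.I * pairing t (cpoint x y₀)) =
      ∫ x, F (cpoint x y₁) * gauss ε (cpoint x y₁) *
        Complex.exp (-2 * Real.pi * Complex.I * pairing t (cpoint x y₁)) := by
  have hseg : segment ℝ y₀ y₁ ⊆ B := hB.segment_subset h₀ h₁
  have hcomp : IsCompact (segment ℝ y₀ y₁) := by
    rw [segment_eq_image']
    exact isCompact_Icc.image (by fun_prop)
  obtain ⟨A, hA⟩ := hbd.exists_bound_compact hcomp hseg
  obtain ⟨R, hR⟩ := hcomp.exists_bound_of_continuousOn (f := fun η =>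
    Real.exp (ε * ‖η‖ ^ 2) * Real.exp (2 * Real.pi * ⟪t, η⟫)) (by fun_prop)
  refine integral_slice_eq_of_bound (B := B) (H := fun z => F z * gauss ε z *
    Complex.exp (-2 * Real.pi * Complex.I * pairing t z)) ?_ hseg
    (((integrable_exp_neg_mul_norm_sq hε).const_mul A).mul_const R) fun η hη x => ?_
  · have := differentiable_pairing t
    exact (hF.mul (differentiable_gauss ε).differentiableOn).mul
      (Differentiable.differentiableOn (by fun_prop))
  · rw [norm_mul, norm_mul, norm_gauss_cpoint, norm_exp_pairing, ← mul_assoc, mul_assoc]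
    have hA0 : 0 ≤ A := (norm_nonneg _).trans (hA η hη x)
    gcongr
    · exact hA η hη x
    · exact (le_abs_self _).trans (hR η hη)

/-- The function `t ↦ χ t exp (2π t · y)`. -/
def twist (y : RSpace n) (χ : RSpace n → ℂ) (t : RSpace n) : ℂ :=
  χ t * Real.exp (2 * Real.pi * ⟪t, y⟫)

theorem contDiff_twist (y : RSpace n) {χ : RSpace n → ℂ} (hχ : ContDiff ℝ ∞ χ) :
    ContDiff ℝ ∞ (twist y χ) := by
  have h : ContDiff ℝ ∞ fun t : RSpace n => Real.exp (2 * Real.pi * ⟪t, y⟫) :=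
    Real.contDiff_exp.comp (contDiff_const.mul (contDiff_id.inner ℝ contDiff_const))
  exact hχ.mul (Complex.ofRealCLM.contDiff.comp h)

theorem hasCompactSupport_twist (y : RSpace n) {χ : RSpace n → ℂ} (hχ : HasCompactSupport χ) :
    HasCompactSupport (twist y χ) := hχ.mul_right

theorem integrable_of_test {h : RSpace n → ℂ} (hs : ContDiff ℝ ∞ h) (hc : HasCompactSupport h) :
    Integrable h := hs.continuous.integrable_of_hasCompactSupport hc

theorem integrable_fourier_of_test {h : RSpace n → ℂ} (hs : ContDiff ℝ ∞ h)
    (hc : HasCompactSupport h) : Integrable (𝓕 h) := by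
  have := (𝓕 (hc.toSchwartzMap hs) : SchwartzMap (RSpace n) ℂ).integrable (μ := volume)
  rwa [SchwartzMap.fourier_coe] at this

theorem continuous_slice {B : Set (RSpace n)} {F : CSpace n → ℂ} (hF : ContinuousOn F (tube B))
    {y : RSpace n} (hy : y ∈ B) : Continuous fun x => F (cpoint x y) :=
  hF.comp_continuous (continuous_cpoint.comp
    (f := fun x : RSpace n => (x, y)) (by fun_prop)) fun _ => cpoint_mem_tube.2 hy

/-- The distributional Fourier transform of the slices of `F`, suitably twisted, does not depend
on the slice. -/
theorem integral_slice_mul_fourier_twist_eq {B : Set (RSpace n)} (hB : Convex ℝ B)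
    {F : CSpace n → ℂ} (hF : DifferentiableOn ℂ F (tube B)) (hbd : LocallyBoundedOnTube B F)
    {χ : RSpace n → ℂ} (hs : ContDiff ℝ ∞ χ) (hc : HasCompactSupport χ)
    {y₀ y₁ : RSpace n} (h₀ : y₀ ∈ B) (h₁ : y₁ ∈ B) :
    ∫ x, F (cpoint x y₀) * 𝓕 (twist y₀ χ) x = ∫ x, F (cpoint x y₁) * 𝓕 (twist y₁ χ) x := by
  have hgc : ∀ (ε : ℝ) (y : RSpace n), Continuous fun x => gauss ε (cpoint x y) := fun ε y =>
    continuous_slice (B := Set.univ) (differentiable_gauss ε).continuous.continuousOn trivial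
  have hlim : ∀ y ∈ B, Tendsto
      (fun ε : ℝ => ∫ x, F (cpoint x y) * gauss ε (cpoint x y) * 𝓕 (twist y χ) x) (𝓝[>] 0)
      (𝓝 (∫ x, F (cpoint x y) * 𝓕 (twist y χ) x)) := by
    intro y hy
    have hint := integrable_fourier_of_test (contDiff_twist y hs) (hasCompactSupport_twist y hc)
    obtain ⟨δ, hδ, A, hA⟩ := hbd y hy
    have hA := hA y (Metric.mem_ball_self hδ)
    have hA0 : 0 ≤ A := (norm_nonneg _).trans (hA 0)
    refine tendsto_integral_filter_of_dominated_convergence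
      (fun x => A * Real.exp (‖y‖ ^ 2) * ‖𝓕 (twist y χ) x‖) ?_ ?_ (hint.norm.const_mul _) ?_
    · refine Eventually.of_forall fun ε => ?_
      exact ((continuous_slice hF.continuousOn hy).mul (hgc ε y)).aestronglyMeasurable.mul
        hint.aestronglyMeasurable
    -- Restricting to `ε < 1` makes the bound on `exp(ε|y|²)` independent of `ε`.
    · have h1 : ∀ᶠ ε : ℝ in 𝓝[>] 0, ε < 1 := mem_nhdsWithin_of_mem_nhds (Iio_mem_nhds one_pos)
      filter_upwards [self_mem_nhdsWithin, h1] with ε hε hε1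
      refine Eventually.of_forall fun x => ?_
      have hε : 0 < ε := hε
      rw [norm_mul, norm_mul, norm_gauss_cpoint]
      have e1 : Real.exp (-ε * ‖x‖ ^ 2) ≤ 1 := Real.exp_le_one_iff.2 (by nlinarith [sq_nonneg ‖x‖])
      have e2 : Real.exp (ε * ‖y‖ ^ 2) ≤ Real.exp (‖y‖ ^ 2) :=
        Real.exp_le_exp.2 (by nlinarith [sq_nonneg ‖y‖])
      have e3 : Real.exp (-ε * ‖x‖ ^ 2) * Real.exp (ε * ‖y‖ ^ 2) ≤ Real.exp (‖y‖ ^ 2) :=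
        (mul_le_of_le_one_left (Real.exp_pos _).le e1).trans e2
      gcongr
      exact hA x
    · refine Eventually.of_forall fun x => tendsto_nhdsWithin_of_tendsto_nhds ?_
      have : Continuous fun ε : ℝ => F (cpoint x y) * gauss ε (cpoint x y) * 𝓕 (twist y χ) x := by
        unfold gauss; fun_prop
      have h := this.tendsto 0
      simpa [gauss] using h
  -- The Fourier transform is moved onto the regularized slice. The twist `exp(2π t·y)` then
  -- completes `exp(-2πi t·x)` to `exp(-2πi t·z)`, which is holomorphic in `z` and allows the
  -- contour shift.
  have hflip : ∀ y ∈ B, ∀ ε : ℝ, 0 < ε →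
      ∫ x, F (cpoint x y) * gauss ε (cpoint x y) * 𝓕 (twist y χ) x =
        ∫ t, χ t * ∫ x, F (cpoint x y) * gauss ε (cpoint x y) *
          Complex.exp (-2 * Real.pi * Complex.I * pairing t (cpoint x y)) := by
    intro y hy ε hε
    obtain ⟨δ, hδ, A, hA⟩ := hbd y hy
    have hA := hA y (Metric.mem_ball_self hδ)
    have hA0 : 0 ≤ A := (norm_nonneg _).trans (hA 0)
    have hgi : Integrable fun x => F (cpoint x y) * gauss ε (cpoint x y) := by
      refine (((integrable_exp_neg_mul_norm_sq hε).mul_const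
        (Real.exp (ε * ‖y‖ ^ 2))).const_mul A).mono' ((continuous_slice hF.continuousOn hy).mul
          (hgc ε y)).aestronglyMeasurable (Eventually.of_forall fun x => ?_)
      rw [norm_mul, norm_gauss_cpoint]
      gcongr
      exact hA x
    have h := VectorFourier.integral_fourierIntegral_smul_eq_flip (L := innerₗ (RSpace n))
      (μ := volume) (ν := volume) Real.continuous_fourierChar continuous_inner
      (integrable_of_test (contDiff_twist y hs) (hasCompactSupport_twist y hc)) hgi
    simp only [smul_eq_mul, flip_innerₗ] at h
    calc _ = ∫ x, 𝓕 (twist y χ) x * (F (cpoint x y) * gauss ε (cpoint x y)) := by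
          simp_rw [mul_comm]
      _ = ∫ t, twist y χ t * 𝓕 (fun x => F (cpoint x y) * gauss ε (cpoint x y)) t := h
      _ = _ := by
        refine integral_congr_ae (Eventually.of_forall fun t => ?_)
        simp only [twist, Real.fourier_eq']
        rw [mul_assoc, ← integral_const_mul]
        congr 2
        ext x
        rw [smul_eq_mul, Complex.ofReal_exp, pairing_cpoint, ← mul_assoc, ← Complex.exp_add,
          mul_comm]
        congr 2
        rw [real_inner_comm t x]
        push_cast
        linear_combination (2 * Real.pi * (⟪t, y⟫ : ℝ)) * Complex.I_sq
  refine tendsto_nhds_unique (hlim y₀ h₀) ((hlim y₁ h₁).congr' ?_)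
  filter_upwards [self_mem_nhdsWithin] with ε hε
  rw [hflip y₀ h₀ ε hε, hflip y₁ h₁ ε hε]
  simp_rw [integral_gauss_exp_eq hB hF hbd hε _ h₀ h₁]

/-! ### `L²` Fourier transforms and a weak Hausdorff–Young inequality -/

/-- A bounded function in `L^p`, `p ≤ 2`, is in `L^2`. -/
theorem memLp_two_of_bound {p : ℝ} (hp : p ≤ 2) {u : RSpace n → ℂ}
    (hm : AEStronglyMeasurable u) {A : ℝ} (hA : ∀ x, ‖u x‖ ≤ A)
    (hu : ∫⁻ x, ‖u x‖ₑ ^ p < ⊤) : MemLp u 2 := by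
  refine ⟨hm, ?_⟩
  rw [eLpNorm_lt_top_iff_lintegral_rpow_enorm_lt_top two_ne_zero ENNReal.ofNat_ne_top]
  have hle : ∀ x, ‖u x‖ₑ ^ (2 : ℝ) ≤ ENNReal.ofReal A ^ (2 - p) * ‖u x‖ₑ ^ p := fun x => by
    have h1 : ‖u x‖ₑ ≤ ENNReal.ofReal A := by
      rw [← ofReal_norm]; exact ENNReal.ofReal_le_ofReal (hA x)
    rcases eq_or_ne ‖u x‖ₑ 0 with h0 | h0
    · simp [h0]
    · calc ‖u x‖ₑ ^ (2 : ℝ) = ‖u x‖ₑ ^ (2 - p) * ‖u x‖ₑ ^ p := by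
            rw [← ENNReal.rpow_add _ _ h0 enorm_ne_top]; norm_num
        _ ≤ _ := by gcongr
  calc ∫⁻ x, ‖u x‖ₑ ^ (2 : ℝ) ≤ ∫⁻ x, ENNReal.ofReal A ^ (2 - p) * ‖u x‖ₑ ^ p :=
        lintegral_mono hle
    _ = ENNReal.ofReal A ^ (2 - p) * ∫⁻ x, ‖u x‖ₑ ^ p :=
        lintegral_const_mul' _ _ (ENNReal.rpow_ne_top_of_nonneg (by linarith) ENNReal.ofReal_ne_top)
    _ < ⊤ := ENNReal.mul_lt_top
        (ENNReal.rpow_lt_top_of_nonneg (by linarith) ENNReal.ofReal_ne_top) hu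

/-- The Fourier transform of an `L²` function, characterized by duality with Schwartz functions. -/
theorem exists_fourier_of_memLp_two {u : RSpace n → ℂ} (hu : MemLp u 2) :
    ∃ v : RSpace n → ℂ, MemLp v 2 ∧
      ∀ h : SchwartzMap (RSpace n) ℂ, ∫ x, u x * 𝓕 (h : RSpace n → ℂ) x = ∫ t, v t * h t := by
  refine ⟨(𝓕 (hu.toLp u) : Lp ℂ 2 (volume : Measure (RSpace n))), Lp.memLp _, fun h => ?_⟩
  have h1 := congrArg (fun T => T h) (Lp.fourier_toTemperedDistribution_eq (hu.toLp u))
  simp only [TemperedDistribution.fourier_apply, Lp.toTemperedDistribution_apply, smul_eq_mul] at h1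
  calc ∫ x, u x * 𝓕 (h : RSpace n → ℂ) x =
        ∫ x, (𝓕 h : SchwartzMap (RSpace n) ℂ) x * (hu.toLp u : RSpace n → ℂ) x := by
        refine integral_congr_ae ?_
        filter_upwards [hu.coeFn_toLp] with x hx
        rw [hx, SchwartzMap.fourier_coe, mul_comm]
    _ = _ := by rw [h1]; simp_rw [mul_comm]

theorem lintegral_enorm_fourier_sq (h : SchwartzMap (RSpace n) ℂ) :
    ∫⁻ x, ‖𝓕 (h : RSpace n → ℂ) x‖ₑ ^ (2 : ℝ) = ∫⁻ t, ‖h t‖ₑ ^ (2 : ℝ) := by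
  have key : ∀ g : SchwartzMap (RSpace n) ℂ,
      ∫⁻ t, ‖g t‖ₑ ^ (2 : ℝ) = ENNReal.ofReal (∫ t, ‖g t‖ ^ 2) := fun g => by
    rw [ofReal_integral_eq_lintegral_ofReal
      ((memLp_two_iff_integrable_sq_norm g.continuous.aestronglyMeasurable).1 (g.memLp 2 (μ := volume)))
      (Eventually.of_forall fun _ => by positivity)]
    refine lintegral_congr fun t => ?_
    rw [ENNReal.ofReal_pow (norm_nonneg _), ofReal_norm, ENNReal.rpow_two]
  rw [key h, ← SchwartzMap.integral_norm_sq_fourier, ← key, SchwartzMap.fourier_coe]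

/-- An upper bound for the `L^q` norm of the Fourier transform of `h`, for `q ≥ 2`. -/
def fourierBound (q : ℝ) (h : RSpace n → ℂ) : ℝ≥0∞ :=
  ((∫⁻ t, ‖h t‖ₑ) ^ (q - 2) * ∫⁻ t, ‖h t‖ₑ ^ (2 : ℝ)) ^ (1 / q)

/-- From `|ĥ| ≤ ‖h‖₁` comes `|ĥ|^q ≤ ‖h‖₁^(q-2) |ĥ|²`, and Plancherel handles the square. This
avoids interpolation, and any finite bound homogeneous of degree one in `h` suffices. -/
theorem lintegral_enorm_fourier_rpow_le {q : ℝ} (hq : 2 ≤ q) (h : SchwartzMap (RSpace n) ℂ) :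
    (∫⁻ x, ‖𝓕 (h : RSpace n → ℂ) x‖ₑ ^ q) ^ (1 / q) ≤ fourierBound q (h : RSpace n → ℂ) := by
  unfold fourierBound
  rw [← lintegral_enorm_fourier_sq]
  have hint : Integrable (h : RSpace n → ℂ) := h.integrable
  have hfin : (∫⁻ t, ‖h t‖ₑ) ^ (q - 2) ≠ ⊤ :=
    ENNReal.rpow_ne_top_of_nonneg (by linarith) hint.2.ne
  rw [← lintegral_const_mul' _ _ hfin]
  gcongr with x
  have hsup : ‖𝓕 (h : RSpace n → ℂ) x‖ₑ ≤ ∫⁻ t, ‖h t‖ₑ := by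
    rw [Real.fourier_eq]
    refine (enorm_integral_le_lintegral_enorm _).trans (le_of_eq (lintegral_congr fun t => ?_))
    rw [← ofReal_norm, ← ofReal_norm, Circle.norm_smul]
  rcases eq_or_ne ‖𝓕 (h : RSpace n → ℂ) x‖ₑ 0 with h0 | h0
  · simp [h0, ENNReal.zero_rpow_of_pos (by linarith : 0 < q)]
  · calc ‖𝓕 (h : RSpace n → ℂ) x‖ₑ ^ q
        = ‖𝓕 (h : RSpace n → ℂ) x‖ₑ ^ (q - 2) * ‖𝓕 (h : RSpace n → ℂ) x‖ₑ ^ (2 : ℝ) := by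
          rw [← ENNReal.rpow_add _ _ h0 enorm_ne_top]; norm_num
      _ ≤ _ := by gcongr

theorem fourierBound_lt_top {q : ℝ} (hq : 2 ≤ q) (h : SchwartzMap (RSpace n) ℂ) :
    fourierBound q (h : RSpace n → ℂ) < ⊤ := by
  have hint : Integrable (h : RSpace n → ℂ) := h.integrable
  have h2 : ∫⁻ t, ‖h t‖ₑ ^ (2 : ℝ) < ⊤ := by
    have := (eLpNorm_lt_top_iff_lintegral_rpow_enorm_lt_top two_ne_zero
      ENNReal.ofNat_ne_top).1 (h.memLp 2 (μ := volume)).2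
    simpa using this
  exact ENNReal.rpow_lt_top_of_nonneg (by positivity) (ENNReal.mul_lt_top
    (ENNReal.rpow_lt_top_of_nonneg (by linarith) hint.2.ne) h2).ne

theorem fourierBound_le_mul {q : ℝ} (hq : 2 ≤ q) {g h : RSpace n → ℂ} {c : ℝ≥0∞} (hc : c ≠ ⊤)
    (hgh : ∀ t, ‖g t‖ₑ ≤ c * ‖h t‖ₑ) : fourierBound q g ≤ c * fourierBound q h := by
  have hq0 : 0 < q := by linarith
  have h1 : ∫⁻ t, ‖g t‖ₑ ≤ c * ∫⁻ t, ‖h t‖ₑ := by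
    rw [← lintegral_const_mul' _ _ hc]; exact lintegral_mono hgh
  have h2 : ∫⁻ t, ‖g t‖ₑ ^ (2 : ℝ) ≤ c ^ (2 : ℝ) * ∫⁻ t, ‖h t‖ₑ ^ (2 : ℝ) := by
    rw [← lintegral_const_mul' _ _ (ENNReal.rpow_ne_top_of_nonneg two_pos.le hc)]
    refine lintegral_mono fun t => ?_
    rw [← ENNReal.mul_rpow_of_nonneg _ _ two_pos.le]
    exact ENNReal.rpow_le_rpow (hgh t) two_pos.le
  have hcq : c ^ (q - 2) * c ^ (2 : ℝ) = c ^ q := by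
    rw [← ENNReal.rpow_add_of_nonneg _ _ (by linarith) two_pos.le]; norm_num
  calc fourierBound q g ≤ ((c * ∫⁻ t, ‖h t‖ₑ) ^ (q - 2) *
        (c ^ (2 : ℝ) * ∫⁻ t, ‖h t‖ₑ ^ (2 : ℝ))) ^ (1 / q) := by
        unfold fourierBound; gcongr
    _ = (c ^ q * ((∫⁻ t, ‖h t‖ₑ) ^ (q - 2) * ∫⁻ t, ‖h t‖ₑ ^ (2 : ℝ))) ^ (1 / q) := by
        rw [ENNReal.mul_rpow_of_nonneg _ _ (by linarith : 0 ≤ q - 2), ← hcq]; ring_nf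
    _ = c * fourierBound q h := by
        rw [ENNReal.mul_rpow_of_nonneg _ _ (by positivity), ← ENNReal.rpow_mul,
          mul_one_div_cancel hq0.ne', ENNReal.rpow_one, fourierBound]

/-- Weak form of the Hausdorff–Young inequality. -/
theorem enorm_integral_mul_fourier_le {p q : ℝ} (hpq : p.HolderConjugate q) (hq : 2 ≤ q)
    {u : RSpace n → ℂ} (hu : AEMeasurable u) (h : SchwartzMap (RSpace n) ℂ) :
    ‖∫ x, u x * 𝓕 (h : RSpace n → ℂ) x‖ₑ ≤
      (∫⁻ x, ‖u x‖ₑ ^ p) ^ (1 / p) * fourierBound q (h : RSpace n → ℂ) := by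
  calc ‖∫ x, u x * 𝓕 (h : RSpace n → ℂ) x‖ₑ
      ≤ ∫⁻ x, ‖u x * 𝓕 (h : RSpace n → ℂ) x‖ₑ := enorm_integral_le_lintegral_enorm _
    _ = ∫⁻ x, ((fun x => ‖u x‖ₑ) * fun x => ‖𝓕 (h : RSpace n → ℂ) x‖ₑ) x :=
        lintegral_congr fun x => enorm_mul _ _
    _ ≤ (∫⁻ x, ‖u x‖ₑ ^ p) ^ (1 / p) * (∫⁻ x, ‖𝓕 (h : RSpace n → ℂ) x‖ₑ ^ q) ^ (1 / q) := by
        refine ENNReal.lintegral_mul_le_Lp_mul_Lq _ hpq hu.enorm ?_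
        have := (𝓕 h : SchwartzMap (RSpace n) ℂ).continuous
        rw [SchwartzMap.fourier_coe] at this
        exact this.enorm.measurable.aemeasurable
    _ ≤ _ := by
        gcongr
        exact lintegral_enorm_fourier_rpow_le hq h

/-- On the support of `χ` the twist is at most `exp(2πm)`. With `m` very negative this is the decay
that competes with the weight. -/
theorem enorm_integral_mul_fourier_twist_le {p q : ℝ} (hpq : p.HolderConjugate q) (hq : 2 ≤ q)
    {u : RSpace n → ℂ} (hu : AEMeasurable u) {χ : RSpace n → ℂ} (hs : ContDiff ℝ ∞ χ)
    (hc : HasCompactSupport χ) {y : RSpace n} {m : ℝ} (hm : ∀ t, χ t ≠ 0 → ⟪t, y⟫ ≤ m) :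
    ‖∫ x, u x * 𝓕 (twist y χ) x‖ₑ ≤
      (∫⁻ x, ‖u x‖ₑ ^ p) ^ (1 / p) *
        (ENNReal.ofReal (Real.exp (2 * Real.pi * m)) * fourierBound q χ) := by
  have h := enorm_integral_mul_fourier_le hpq hq hu
    ((hasCompactSupport_twist y hc).toSchwartzMap (contDiff_twist y hs))
  refine h.trans ?_
  gcongr
  refine fourierBound_le_mul hq ENNReal.ofReal_ne_top fun t => ?_
  change ‖twist y χ t‖ₑ ≤ _
  by_cases ht : χ t = 0
  · simp [twist, ht]
  rw [twist, enorm_mul, mul_comm, ← ofReal_norm (Complex.ofReal _), Complex.norm_real,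
    Real.norm_eq_abs, abs_of_pos (Real.exp_pos _)]
  gcongr
  exact hm t ht

/-! ### Cones and the location of the spectrum -/

theorem IsOpenConvexCone.smul_mem {Γ : Set (RSpace n)} (hΓ : IsOpenConvexCone Γ) {c : ℝ}
    (hc : 0 < c) {y : RSpace n} (hy : y ∈ Γ) : c • y ∈ Γ := by
  have h := hΓ.combo_mem y hy y hy (c / 2) (c / 2) (half_pos hc) (half_pos hc)
  rwa [← add_smul, add_halves] at h

theorem IsOpenConvexCone.convex {Γ : Set (RSpace n)} (hΓ : IsOpenConvexCone Γ) : Convex ℝ Γ :=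
  convex_iff_forall_pos.2 fun _ hx _ hy _ _ ha hb _ => hΓ.combo_mem _ hx _ hy _ _ ha hb

theorem IsOpenConvexCone.neg {Γ : Set (RSpace n)} (hΓ : IsOpenConvexCone Γ) :
    IsOpenConvexCone (-Γ) where
  isOpen := hΓ.isOpen.neg
  nonempty := hΓ.nonempty.neg
  zero_notMem := by simpa using hΓ.zero_notMem
  combo_mem := fun x hx y hy a b ha hb => by
    have h := hΓ.combo_mem (-x) hx (-y) hy a b ha hb
    rw [Set.mem_neg]
    simpa [add_comm] using h

/-- A nonempty open cone has infinite measure outside every ball. -/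
theorem volume_cone_inter_eq_top {T : Set (RSpace n)} (hT : IsOpen T)
    (hsmul : ∀ c : ℝ, 0 < c → ∀ y ∈ T, c • y ∈ T) {y₀ : RSpace n} (hy₀ : y₀ ∈ T) (h0 : y₀ ≠ 0)
    (R : ℝ) : volume (T ∩ {y | R ≤ ‖y‖}) = ⊤ := by
  have : Nontrivial (RSpace n) := ⟨y₀, 0, h0⟩
  have hpos : 0 < ‖y₀‖ := norm_pos_iff.2 h0
  obtain ⟨κ', hκ', hsub'⟩ := Metric.isOpen_iff.1 hT y₀ hy₀
  -- Radius at most `|y₀|/2` keeps the dilated ball about `k y₀` outside the ball of radius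
  -- `k|y₀|/2` about the origin, while its volume grows like a positive power of `k`.
  set κ := min κ' (‖y₀‖ / 2)
  have hκ : 0 < κ := lt_min hκ' (half_pos hpos)
  have hsub : Metric.ball y₀ κ ⊆ T := (Metric.ball_subset_ball (min_le_left _ _)).trans hsub'
  have hball : ∀ k : ℝ, 0 < k → R ≤ k * (‖y₀‖ / 2) →
      Metric.ball (k • y₀) (k * κ) ⊆ T ∩ {y | R ≤ ‖y‖} := by
    intro k hk hR y hy
    have hy' : k⁻¹ • y ∈ Metric.ball y₀ κ := by
      rw [mem_ball_iff_norm] at hy ⊢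
      have : k⁻¹ • y - y₀ = k⁻¹ • (y - k • y₀) := by rw [smul_sub, inv_smul_smul₀ hk.ne']
      rw [this, norm_smul, Real.norm_eq_abs, abs_of_pos (inv_pos.2 hk), inv_mul_lt_iff₀ hk]
      exact hy
    refine ⟨?_, ?_⟩
    · have := hsmul k hk _ (hsub hy')
      rwa [smul_inv_smul₀ hk.ne'] at this
    · rw [mem_ball_iff_norm] at hy
      have h1 : ‖k • y₀‖ - ‖y‖ ≤ ‖y - k • y₀‖ := by
        rw [norm_sub_rev]; exact norm_sub_norm_le _ _
      rw [norm_smul, Real.norm_eq_abs, abs_of_pos hk] at h1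
      have h2 : k * κ ≤ k * (‖y₀‖ / 2) := by gcongr; exact min_le_right _ _
      change R ≤ ‖y‖
      linarith
  by_contra hne
  have hv : volume (Metric.ball (0 : RSpace n) κ) ≠ 0 := (Metric.measure_ball_pos _ _ hκ).ne'
  obtain ⟨N, hN⟩ := ENNReal.exists_nat_mul_gt hv hne
  obtain ⟨N', hN'⟩ := exists_nat_ge (R / (‖y₀‖ / 2))
  set k : ℕ := max (max N N') 1
  have hk1 : (1 : ℝ) ≤ k := by exact_mod_cast le_max_right _ _
  have hkN : (N : ℝ) ≤ k := by exact_mod_cast (le_max_left N N').trans (le_max_left _ _)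
  have hkN' : (N' : ℝ) ≤ k := by exact_mod_cast (le_max_right N N').trans (le_max_left _ _)
  have hR : R ≤ k * (‖y₀‖ / 2) := (div_le_iff₀ (half_pos hpos)).1 (hN'.trans hkN')
  have h1 := measure_mono (μ := volume) (hball k (by linarith) hR)
  rw [Measure.addHaar_ball_mul_of_pos _ _ (by linarith : (0 : ℝ) < k)] at h1
  have h2 : (N : ℝ≥0∞) ≤ ENNReal.ofReal ((k : ℝ) ^ Module.finrank ℝ (RSpace n)) := by
    rw [← ENNReal.ofReal_natCast]
    exact ENNReal.ofReal_le_ofReal (hkN.trans (le_self_pow₀ hk1 Module.finrank_pos.ne'))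
  exact absurd (hN.trans_le ((mul_le_mul_left h2 _).trans h1)) (lt_irrefl _)

/-- If a weight has linear growth, the spectrum of a function of the weighted Bergman space on a
tube over a cone lies in the half-spaces given by the growth. -/
theorem MemBergman.integral_mul_fourier_twist_eq_zero {p q s : ℝ} (hpq : p.HolderConjugate q)
    (hq : 2 ≤ q) (hs : 0 < s) {B : Set (RSpace n)} (hB : IsOpenConvexCone B)
    {ψ : RSpace n → ℝ} {F : CSpace n → ℂ} (hF : MemBergman p s B ψ F)
    (hbd : LocallyBoundedOnTube B F) {C R : ℝ} (hψ : ∀ y ∈ B, R ≤ ‖y‖ → ψ y ≤ C * ‖y‖)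
    {t₀ y₀ : RSpace n} (hy₀ : y₀ ∈ B) {ρ : ℝ} (hρ : ⟪t₀, y₀⟫ + ρ * ‖y₀‖ < -C * ‖y₀‖)
    {χ : RSpace n → ℂ} (hχ : ContDiff ℝ ∞ χ) (hc : HasCompactSupport χ)
    (hsupp : ∀ t, χ t ≠ 0 → t ∈ Metric.ball t₀ ρ) {y : RSpace n} (hy : y ∈ B) :
    ∫ x, F (cpoint x y) * 𝓕 (twist y χ) x = 0 := by
  have hp : 0 < p := hpq.pos
  -- The heights at which all of the support of `χ` lies in the forbidden half-space. They form an
  -- open cone, so they have infinite measure even after truncation at `R`.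
  set T : Set (RSpace n) := B ∩ {y | ⟪t₀, y⟫ + ρ * ‖y‖ < -C * ‖y‖}
  have hT : IsOpen T := hB.isOpen.inter (isOpen_lt (by fun_prop) (by fun_prop))
  have hTs : ∀ c : ℝ, 0 < c → ∀ y ∈ T, c • y ∈ T := by
    rintro c hc y ⟨hyB, hy⟩
    refine ⟨hB.smul_mem hc hyB, ?_⟩
    rw [Set.mem_ofPred_eq] at hy ⊢
    rw [inner_smul_right, norm_smul, Real.norm_eq_abs, abs_of_pos hc]
    nlinarith
  have hvol := volume_cone_inter_eq_top hT hTs ⟨hy₀, hρ⟩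
    (fun h => hB.zero_notMem (h ▸ hy₀)) R
  set S := T ∩ {y | R ≤ ‖y‖}
  have hSm : MeasurableSet S :=
    hT.measurableSet.inter (isClosed_le continuous_const continuous_norm).measurableSet
  set Λ := ∫ x, F (cpoint x y) * 𝓕 (twist y χ) x
  have hfb : fourierBound q χ < ⊤ := fourierBound_lt_top hq (hc.toSchwartzMap hχ)
  set c := fourierBound q χ ^ (p * s)
  have hct : c ≠ ⊤ := ENNReal.rpow_ne_top_of_nonneg (by positivity) hfb.ne
  -- `Λ` does not depend on the slice, so it can be estimated at every height `η` in `S`, where `t·η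
  -- ≤ -C|η| ≤ -ψ(η)` on the support of `χ`.
  have hle : ∀ η ∈ S, ‖Λ‖ₑ ^ (p * s) ≤ c * (sliceNorm p F η ^ s *
      ENNReal.ofReal (Real.exp (-2 * Real.pi * p * s * ψ η))) := by
    rintro η ⟨⟨hηB, hη⟩, hηR⟩
    have h1 : ‖Λ‖ₑ ≤ sliceNorm p F η ^ (1 / p) *
        (ENNReal.ofReal (Real.exp (2 * Real.pi * (-ψ η))) * fourierBound q χ) := by
      have h2 : Λ = ∫ x, F (cpoint x η) * 𝓕 (twist η χ) x :=
        integral_slice_mul_fourier_twist_eq hB.convex hF.holomorphic hbd hχ hc hy hηB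
      rw [h2]
      refine enorm_integral_mul_fourier_twist_le hpq hq
        (continuous_slice hF.holomorphic.continuousOn hηB).measurable.aemeasurable hχ hc
        fun t ht => ?_
      have ht' := mem_ball_iff_norm.1 (hsupp t ht)
      have h3 : ⟪t - t₀, η⟫ ≤ ρ * ‖η‖ :=
        (real_inner_le_norm _ _).trans (by gcongr)
      rw [inner_sub_left] at h3
      have h4 := hψ η hηB hηR
      rw [Set.mem_ofPred_eq] at hη
      linarith
    calc ‖Λ‖ₑ ^ (p * s) ≤ (sliceNorm p F η ^ (1 / p) *
        (ENNReal.ofReal (Real.exp (2 * Real.pi * (-ψ η))) * fourierBound q χ)) ^ (p * s) := by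
          gcongr
      _ = _ := by
        rw [ENNReal.mul_rpow_of_nonneg _ _ (by positivity),
          ENNReal.mul_rpow_of_nonneg _ _ (by positivity), ← ENNReal.rpow_mul,
          ENNReal.ofReal_rpow_of_pos (Real.exp_pos _), ← Real.exp_mul,
          show 1 / p * (p * s) = s by field_simp,
          show 2 * Real.pi * (-ψ η) * (p * s) = -2 * Real.pi * p * s * ψ η by ring]
        ring
  have hint : ‖Λ‖ₑ ^ (p * s) * volume S < ⊤ := by
    calc ‖Λ‖ₑ ^ (p * s) * volume S = ∫⁻ η in S, ‖Λ‖ₑ ^ (p * s) := by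
          rw [lintegral_const, Measure.restrict_apply_univ]
      _ ≤ ∫⁻ η in S, c * (sliceNorm p F η ^ s *
            ENNReal.ofReal (Real.exp (-2 * Real.pi * p * s * ψ η))) := setLIntegral_mono' hSm hle
      _ = c * ∫⁻ η in S, (sliceNorm p F η ^ s *
            ENNReal.ofReal (Real.exp (-2 * Real.pi * p * s * ψ η))) :=
          lintegral_const_mul' _ _ hct
      _ < ⊤ := ENNReal.mul_lt_top hct.lt_top ((lintegral_mono_set fun η hη => hη.1.1).trans_lt
          (hF.lintegral_lt_top hp hs hB.isOpen))
  by_contra hΛ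
  rw [hvol, ENNReal.mul_top] at hint
  · exact lt_irrefl _ hint
  · simpa [ENNReal.rpow_eq_zero_iff, hp, hs] using hΛ

theorem twist_neg_twist (y : RSpace n) (f : RSpace n → ℂ) : twist (-y) (twist y f) = f := by
  ext t
  simp only [twist]
  rw [mul_assoc, ← Complex.ofReal_mul, ← Real.exp_add]
  simp

theorem twist_twist_neg (y : RSpace n) (f : RSpace n → ℂ) : twist y (twist (-y) f) = f := by
  simpa using twist_neg_twist (-y) f

theorem twist_mul_left (y : RSpace n) (f g : RSpace n → ℂ) (t : RSpace n) :
    twist y f t * g t = f t * twist y g t := by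
  simp only [twist]; ring

theorem locallyIntegrable_twist (y : RSpace n) {f : RSpace n → ℂ} (hf : LocallyIntegrable f) :
    LocallyIntegrable (twist y f) := by
  refine locallyIntegrable_iff.2 fun K hK => ?_
  refine (hf.integrableOn_isCompact hK).mul_continuousOn ?_ hK
  fun_prop

/-- Two locally integrable functions that integrate equally against test functions agree almost
everywhere. -/
theorem ae_eq_of_integral_mul_test_eq {f g : RSpace n → ℂ} (hf : LocallyIntegrable f)
    (hg : LocallyIntegrable g) (h : ∀ χ : RSpace n → ℂ, ContDiff ℝ ∞ χ → HasCompactSupport χ →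
      ∫ t, f t * χ t = ∫ t, g t * χ t) : f =ᵐ[volume] g := by
  refine ae_eq_of_integral_contDiff_smul_eq hf hg fun φ hφ hc => ?_
  have := h (fun t => (φ t : ℂ)) (Complex.ofRealCLM.contDiff.comp hφ)
    (hc.comp_left Complex.ofReal_zero)
  simpa only [Complex.real_smul, mul_comm] using this

/-- The spectral function of a function of a weighted Bergman space over a cone. -/
theorem MemBergman.exists_spectralFunction {p q s : ℝ} (hpq : p.HolderConjugate q)
    (hp2 : p ≤ 2) (hq : 2 ≤ q) (hs : 0 < s) {B : Set (RSpace n)} (hB : IsOpenConvexCone B)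
    {ψ : RSpace n → ℝ} (hψc : ContinuousOn ψ B) {F : CSpace n → ℂ} (hF : MemBergman p s B ψ F)
    {C R : ℝ} (hψ : ∀ y ∈ B, R ≤ ‖y‖ → ψ y ≤ C * ‖y‖) :
    ∃ f : RSpace n → ℂ, LocallyIntegrable f ∧
      (∀ y ∈ B, ∀ χ : RSpace n → ℂ, ContDiff ℝ ∞ χ → HasCompactSupport χ →
        ∫ x, F (cpoint x y) * 𝓕 χ x = ∫ t, twist (-y) f t * χ t) ∧
      (∀ᵐ t, (∃ y ∈ B, ⟪t, y⟫ < -C * ‖y‖) → f t = 0) ∧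
      (∀ y ∈ B, sliceNorm p F y < ⊤ → ∀ h : SchwartzMap (RSpace n) ℂ,
        ∫ x, F (cpoint x y) * 𝓕 (h : RSpace n → ℂ) x = ∫ t, twist (-y) f t * h t) := by
  have hp : 0 < p := hpq.pos
  have hbd : LocallyBoundedOnTube B F := fun y hy => hF.exists_bound hp hs hB.isOpen hψc hy
  have hfou : ∀ y ∈ B, sliceNorm p F y < ⊤ → ∃ v : RSpace n → ℂ, MemLp v 2 ∧
      ∀ h : SchwartzMap (RSpace n) ℂ,
        ∫ x, F (cpoint x y) * 𝓕 (h : RSpace n → ℂ) x = ∫ t, v t * h t := by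
    intro y hy hfin
    obtain ⟨δ, hδ, A, hA⟩ := hbd y hy
    exact exists_fourier_of_memLp_two (memLp_two_of_bound hp2
      (continuous_slice hF.holomorphic.continuousOn hy).aestronglyMeasurable
      (hA y (Metric.mem_ball_self hδ)) hfin)
  obtain ⟨y₁, hy₁⟩ := hB.nonempty
  obtain ⟨y₀, hy₀, -, hfin⟩ := hF.exists_sliceNorm_lt_top hp hs hB.isOpen hψc hy₁ one_pos
  obtain ⟨v, hv, hvF⟩ := hfou y₀ hy₀ hfin
  have hvloc : LocallyIntegrable v := hv.locallyIntegrable one_le_two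
  have hloc : LocallyIntegrable (twist y₀ v) := locallyIntegrable_twist y₀ hvloc
  have htest : ∀ y ∈ B, ∀ χ : RSpace n → ℂ, ContDiff ℝ ∞ χ → HasCompactSupport χ →
      ∫ x, F (cpoint x y) * 𝓕 (twist y χ) x = ∫ t, twist y₀ v t * χ t := by
    intro y hy χ hχ hc
    rw [integral_slice_mul_fourier_twist_eq hB.convex hF.holomorphic hbd hχ hc hy hy₀]
    simp_rw [twist_mul_left]
    exact hvF ((hasCompactSupport_twist y₀ hc).toSchwartzMap (contDiff_twist y₀ hχ))
  have htest' : ∀ y ∈ B, ∀ χ : RSpace n → ℂ, ContDiff ℝ ∞ χ → HasCompactSupport χ →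
      ∫ x, F (cpoint x y) * 𝓕 χ x = ∫ t, twist (-y) (twist y₀ v) t * χ t := by
    intro y hy χ hχ hc
    have h := htest y hy (twist (-y) χ) (contDiff_twist _ hχ) (hasCompactSupport_twist _ hc)
    rw [twist_twist_neg] at h
    simp_rw [h, twist_mul_left (-y)]
  refine ⟨twist y₀ v, hloc, htest', ?_, ?_⟩
  · rw [ae_iff]
    refine measure_null_of_locally_null _ fun t₀ ht₀ => ?_
    simp only [Set.mem_ofPred_eq, Classical.not_imp] at ht₀
    obtain ⟨⟨y, hy, hty⟩, -⟩ := ht₀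
    have hpos : 0 < ‖y‖ := norm_pos_iff.2 fun h => hB.zero_notMem (h ▸ hy)
    -- `ρ|y|` is half the gap in the strict inequality at `t₀`.
    obtain ⟨ρ, hρ0, hρ⟩ : ∃ ρ : ℝ, 0 < ρ ∧ ⟪t₀, y⟫ + ρ * ‖y‖ < -C * ‖y‖ := by
      refine ⟨(-C * ‖y‖ - ⟪t₀, y⟫) / (2 * ‖y‖), div_pos (by linarith) (by linarith), ?_⟩
      have : (-C * ‖y‖ - ⟪t₀, y⟫) / (2 * ‖y‖) * ‖y‖ = (-C * ‖y‖ - ⟪t₀, y⟫) / 2 := by field_simp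
      rw [this]; linarith
    have hae := Metric.isOpen_ball.ae_eq_zero_of_integral_contDiff_smul_eq_zero
      (U := Metric.ball t₀ ρ) (hloc.locallyIntegrableOn _) (fun φ hφ hc hsub => by
        have h1 := htest y hy (fun t => (φ t : ℂ)) (Complex.ofRealCLM.contDiff.comp hφ)
          (hc.comp_left Complex.ofReal_zero)
        rw [hF.integral_mul_fourier_twist_eq_zero hpq hq hs hB hbd hψ hy hρ
          (χ := fun t => (φ t : ℂ)) (Complex.ofRealCLM.contDiff.comp hφ)
          (hc.comp_left Complex.ofReal_zero)
          (fun t ht => hsub (subset_tsupport _ (fun h0 => ht (by simp [h0])))) hy] at h1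
        simpa only [Complex.real_smul, mul_comm] using h1.symm)
    refine ⟨Metric.ball t₀ ρ ∩ {t | ¬((∃ y ∈ B, ⟪t, y⟫ < -C * ‖y‖) → twist y₀ v t = 0)},
      inter_mem (mem_nhdsWithin_of_mem_nhds (Metric.ball_mem_nhds _ hρ0)) self_mem_nhdsWithin, ?_⟩
    refine measure_mono_null ?_ (ae_iff.1 hae)
    rintro t ⟨ht, ht'⟩ hcon
    exact ht' fun _ => hcon ht
  · intro y hy hfin h
    obtain ⟨w, hw, hwF⟩ := hfou y hy hfin
    -- Compactly supported tests identify the `L²` transform `w` of this slice with the twisted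
    -- spectral function. The identity then extends to Schwartz tests, which Fourier inversion
    -- requires.
    have hae : w =ᵐ[volume] twist (-y) (twist y₀ v) := by
      refine ae_eq_of_integral_mul_test_eq (hw.locallyIntegrable one_le_two)
        (locallyIntegrable_twist _ hloc) fun χ hχ hc => ?_
      rw [← htest' y hy χ hχ hc]
      exact (hwF (hc.toSchwartzMap hχ)).symm
    rw [hwF h]
    refine integral_congr_ae ?_
    filter_upwards [hae] with t ht
    rw [ht]

/-! ### Fourier–Laplace integrals and inversion -/

/-- The pairing with a real vector, as a continuous linear functional. -/
def pairingL (t : RSpace n) : CSpace n →L[ℂ] ℂ :=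
  ∑ k, (t k : ℂ) • EuclideanSpace.proj k

theorem pairingL_apply (t : RSpace n) (z : CSpace n) : pairingL t z = pairing t z := by
  simp [pairingL, pairing]

theorem continuous_pairingL : Continuous (pairingL (n := n)) := by
  unfold pairingL
  have h : ∀ k : Fin n, Continuous fun t : RSpace n => (t k : ℂ) := fun k => by fun_prop
  exact continuous_finsetSum _ fun k _ => (h k).smul continuous_const

/-- The Fourier–Laplace integral of `f`. -/
def laplaceIntegral (f : RSpace n → ℂ) (z : CSpace n) : ℂ :=
  ∫ t, f t * Complex.exp (2 * Real.pi * Complex.I * pairing t z)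

/-- The Fourier–Laplace integral of an integrable function of bounded support is entire. -/
theorem differentiable_laplaceIntegral {f : RSpace n → ℂ} (hf : Integrable f) {K : Set (RSpace n)}
    (hK : Bornology.IsBounded K) (hfK : ∀ t, t ∉ K → f t = 0) :
    Differentiable ℂ (laplaceIntegral f) := by
  intro z₀
  obtain ⟨r, hr⟩ := hK.subset_closedBall 0
  obtain ⟨N, hN⟩ := (isCompact_closedBall (0 : RSpace n) r).exists_bound_of_continuousOn
    continuous_pairingL.continuousOn
  have hN0 : ∀ t ∈ K, ‖pairingL t‖ ≤ N := fun t ht => hN t (hr ht)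
  set E : CSpace n → RSpace n → ℂ := fun z t =>
    Complex.exp (2 * Real.pi * Complex.I * pairingL t z)
  have hEc : ∀ z, Continuous (E z) := fun z => by
    have := continuous_pairingL (n := n)
    fun_prop
  have hE : ∀ t ∈ K, ∀ z ∈ Metric.ball z₀ 1,
      ‖E z t‖ ≤ Real.exp (2 * Real.pi * (N * (‖z₀‖ + 1))) := by
    intro t ht z hz
    have hz' : ‖z‖ ≤ ‖z₀‖ + 1 := by
      have h1 := mem_ball_iff_norm.1 hz
      have h2 := norm_add_le (z - z₀) z₀
      rw [sub_add_cancel] at h2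
      linarith
    have hN' : 0 ≤ N := (norm_nonneg _).trans (hN0 t ht)
    refine (Complex.norm_exp_le_exp_norm _).trans (Real.exp_le_exp.2 ?_)
    rw [norm_mul]
    have h3 : ‖(2 * Real.pi * Complex.I : ℂ)‖ = 2 * Real.pi := by
      simp [abs_of_pos Real.pi_pos]
    rw [h3]
    gcongr
    exact (pairingL t).le_opNorm_of_le hz' |>.trans (by gcongr; exact hN0 t ht)
  have hcont : ∀ z, Continuous fun t : RSpace n =>
      E z t • ((2 * Real.pi * Complex.I : ℂ) • pairingL t) := fun z => by
    have hs : Continuous fun t : RSpace n => (2 * Real.pi * Complex.I : ℂ) • pairingL t :=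
      continuous_pairingL.const_smul (2 * Real.pi * Complex.I : ℂ)
    exact (hEc z).smul hs
  have hmeas : ∀ z, AEStronglyMeasurable (fun t => f t * E z t) := fun z =>
    hf.aestronglyMeasurable.mul (hEc z).aestronglyMeasurable
  have hfE : Integrable (fun t => f t * E z₀ t) := by
    refine (hf.norm.mul_const (Real.exp (2 * Real.pi * (N * (‖z₀‖ + 1))))).mono' (hmeas z₀)
      (Eventually.of_forall fun t => ?_)
    by_cases ht : t ∈ K
    · rw [norm_mul]; gcongr; exact hE t ht z₀ (Metric.mem_ball_self one_pos)
    · simp [hfK t ht]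
  have h := hasFDerivAt_integral_of_dominated_of_fderiv_le (𝕜 := ℂ) (μ := volume)
    (F := fun z t => f t * E z t)
    (F' := fun z t => f t • (E z t • ((2 * Real.pi * Complex.I : ℂ) • pairingL t)))
    (bound := fun t => ‖f t‖ * (Real.exp (2 * Real.pi * (N * (‖z₀‖ + 1))) * (2 * Real.pi * N)))
    (x₀ := z₀) (Metric.ball_mem_nhds z₀ one_pos) (Eventually.of_forall hmeas) hfE
    (hf.aestronglyMeasurable.smul (hcont z₀).aestronglyMeasurable)
    (Eventually.of_forall fun t z hz => by
      by_cases ht : t ∈ K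
      · rw [norm_smul, norm_smul, norm_smul]
        have h3 : ‖(2 * Real.pi * Complex.I : ℂ)‖ = 2 * Real.pi := by
          simp [abs_of_pos Real.pi_pos]
        rw [h3]
        gcongr
        · exact hE t ht z hz
        · exact hN0 t ht
      · simp [hfK t ht])
    (hf.norm.mul_const _)
    (Eventually.of_forall fun t z _ => by
      have h1 : HasFDerivAt (fun z => 2 * Real.pi * Complex.I * pairingL t z)
          ((2 * Real.pi * Complex.I : ℂ) • pairingL t) z :=
        (pairingL t).hasFDerivAt.const_mul _
      exact h1.cexp.const_mul (f t))
  simp only [E, pairingL_apply] at h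
  exact h.differentiableAt

/-- On a slice, the Fourier–Laplace integral is an inverse Fourier transform. -/
theorem laplaceIntegral_cpoint (f : RSpace n → ℂ) (x y : RSpace n) :
    laplaceIntegral f (cpoint x y) = 𝓕⁻ (twist (-y) f) x := by
  rw [laplaceIntegral, Real.fourierInv_eq']
  refine integral_congr_ae (Eventually.of_forall fun t => ?_)
  simp only [twist]
  rw [smul_eq_mul, mul_comm, Complex.ofReal_exp, mul_left_comm, ← Complex.exp_add, mul_comm,
    pairing_cpoint]
  congr 2
  rw [inner_neg_right]
  push_cast
  linear_combination (2 * Real.pi * (⟪t, y⟫ : ℝ)) * Complex.I_sq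

theorem integral_fourierInv_mul_eq {w g : RSpace n → ℂ} (hw : Integrable w) (hg : Integrable g) :
    ∫ x, 𝓕⁻ w x * g x = ∫ t, w t * 𝓕⁻ g t := by
  have h := VectorFourier.integral_fourierIntegral_smul_eq_flip (L := -innerₗ (RSpace n))
    (μ := volume) (ν := volume) Real.continuous_fourierChar continuous_inner.neg hw hg
  have hflip : (-innerₗ (RSpace n)).flip = -innerₗ (RSpace n) := by
    ext v w; simp [real_inner_comm]
  rw [hflip] at h
  exact h

/-- A continuous function whose distributional Fourier transform is an integrable function is
given by the inversion formula. -/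
theorem eq_fourierInv_of_integral_mul_fourier_eq {u w : RSpace n → ℂ} (hu : Continuous u)
    (hw : Integrable w) (h : ∀ g : SchwartzMap (RSpace n) ℂ,
      ∫ x, u x * 𝓕 (g : RSpace n → ℂ) x = ∫ t, w t * g t) : u = 𝓕⁻ w := by
  have hc : Continuous (𝓕⁻ w) :=
    VectorFourier.fourierIntegral_continuous Real.continuous_fourierChar
      (L := -innerₗ (RSpace n)) continuous_inner.neg hw
  refine (Continuous.ae_eq_iff_eq volume hu hc).1 (ae_eq_of_integral_mul_test_eq
    hu.locallyIntegrable hc.locallyIntegrable fun χ hχ hs => ?_)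
  set g : SchwartzMap (RSpace n) ℂ := hs.toSchwartzMap hχ
  have hg : (g : RSpace n → ℂ) = χ := rfl
  -- Testing with `𝓕⁻ χ` turns the hypothesis into `∫ u χ = ∫ w 𝓕⁻ χ = ∫ (𝓕⁻ w) χ`.
  have h1 := h (𝓕⁻ g)
  rw [← SchwartzMap.fourier_coe, FourierTransform.fourier_fourierInv_eq,
    SchwartzMap.fourierInv_coe, hg, ← integral_fourierInv_mul_eq hw
      (integrable_of_test hχ hs)] at h1
  exact h1

/-! ### Equality of the two spectral functions -/

theorem integrable_twist_mul {f χ : RSpace n → ℂ} (hf : LocallyIntegrable f)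
    (hχ : ContDiff ℝ ∞ χ) (hc : HasCompactSupport χ) (y : RSpace n) :
    Integrable fun t => twist y f t * χ t :=
  (locallyIntegrable_twist y hf).integrable_smul_right_of_hasCompactSupport hχ.continuous hc

/-- On the compact support of `χ` the exponential is bounded uniformly for `y` near `y₀`, so
dominated convergence applies. This allows `y` to tend to 0, which lies outside the cone. -/
theorem continuous_integral_twist_mul {f χ : RSpace n → ℂ} (hf : LocallyIntegrable f)
    (hχ : ContDiff ℝ ∞ χ) (hc : HasCompactSupport χ) :
    Continuous fun y => ∫ t, twist y f t * χ t := by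
  obtain ⟨r, hr⟩ := hc.isCompact.isBounded.subset_closedBall 0
  refine continuous_iff_continuousAt.2 fun y₀ => ?_
  refine continuousAt_of_dominated
    (bound := fun t => ‖twist 0 f t * χ t‖ * Real.exp (2 * Real.pi * (r * (‖y₀‖ + 1)))) ?_ ?_
    ((integrable_twist_mul hf hχ hc 0).norm.mul_const _) ?_
  · exact Eventually.of_forall fun y => (integrable_twist_mul hf hχ hc y).aestronglyMeasurable
  · filter_upwards [Metric.ball_mem_nhds y₀ one_pos] with y hy
    refine Eventually.of_forall fun t => ?_
    by_cases ht : χ t = 0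
    · simp [ht]
    have ht' : ‖t‖ ≤ r := by simpa using hr (subset_tsupport _ ht)
    have hr0 : 0 ≤ r := (norm_nonneg _).trans ht'
    have hy' : ‖y‖ ≤ ‖y₀‖ + 1 := by
      have h1 := mem_ball_iff_norm.1 hy
      have h2 := norm_add_le (y - y₀) y₀
      rw [sub_add_cancel] at h2
      linarith
    have hin : ⟪t, y⟫ ≤ r * (‖y₀‖ + 1) :=
      (real_inner_le_norm _ _).trans (by gcongr)
    simp only [twist, norm_mul, inner_zero_right, mul_zero, Real.exp_zero, Complex.ofReal_one,
      mul_one, Complex.norm_real, Real.norm_eq_abs, abs_of_pos (Real.exp_pos _)]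
    rw [mul_right_comm]
    gcongr
  · refine Eventually.of_forall fun t => Continuous.continuousAt ?_
    unfold twist
    fun_prop

/-- Two spectral functions agree if the slices of the two functions approach each other along
some sequence of slices. -/
theorem ae_eq_of_liminf_eq_zero {p q : ℝ} (hpq : p.HolderConjugate q) (hq : 2 ≤ q)
    {Γ : Set (RSpace n)} {F₁ F₂ : CSpace n → ℂ} (hF₁ : ContinuousOn F₁ (tube Γ))
    (hF₂ : ContinuousOn F₂ (tube (-Γ)))
    (hb₁ : LocallyBoundedOnTube Γ F₁) (hb₂ : LocallyBoundedOnTube (-Γ) F₂)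
    {f₁ f₂ : RSpace n → ℂ} (hf₁ : LocallyIntegrable f₁) (hf₂ : LocallyIntegrable f₂)
    (h₁ : ∀ y ∈ Γ, ∀ χ : RSpace n → ℂ, ContDiff ℝ ∞ χ → HasCompactSupport χ →
      ∫ x, F₁ (cpoint x y) * 𝓕 χ x = ∫ t, twist (-y) f₁ t * χ t)
    (h₂ : ∀ y ∈ -Γ, ∀ χ : RSpace n → ℂ, ContDiff ℝ ∞ χ → HasCompactSupport χ →
      ∫ x, F₂ (cpoint x y) * 𝓕 χ x = ∫ t, twist (-y) f₂ t * χ t)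
    (hlim : liminf (fun y : RSpace n =>
      ∫⁻ x : RSpace n, ‖F₁ (cpoint x y) - F₂ (cpoint x (-y))‖ₑ ^ p) (𝓝[Γ] 0) = 0) :
    f₁ =ᵐ[volume] f₂ := by
  have hp : 0 < p := hpq.pos
  refine ae_eq_of_integral_mul_test_eq hf₁ hf₂ fun χ hχ hc => ?_
  set N : RSpace n → ℝ≥0∞ := fun y =>
    ∫⁻ x : RSpace n, ‖F₁ (cpoint x y) - F₂ (cpoint x (-y))‖ₑ ^ p
  -- For `y ∈ Γ` this is the pairing of the difference of slices with `𝓕 χ`, and at 0 it is the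
  -- pairing of `f₁ - f₂` with `χ`. If `Δ 0 ≠ 0`, continuity and Hausdorff–Young bound `N` below
  -- near 0, against the liminf.
  set Δ : RSpace n → ℂ := fun y => (∫ t, twist (-y) f₁ t * χ t) - ∫ t, twist y f₂ t * χ t
  have hΔc : Continuous Δ := ((continuous_integral_twist_mul hf₁ hχ hc).comp continuous_neg).sub
    (continuous_integral_twist_mul hf₂ hχ hc)
  have hΔ : ∀ y ∈ Γ, ‖Δ y‖ₑ ≤ N y ^ (1 / p) * fourierBound q χ := by
    intro y hy
    have hy' : -y ∈ -Γ := by simpa using hy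
    have c₁ := continuous_slice hF₁ hy
    have c₂ := continuous_slice hF₂ hy'
    have hint := integrable_fourier_of_test hχ hc
    have hi : ∀ u : RSpace n → ℂ, Continuous u → (∃ A, ∀ x, ‖u x‖ ≤ A) →
        Integrable fun x => u x * 𝓕 χ x := fun u hu ⟨A, hA⟩ =>
      hint.bdd_mul hu.aestronglyMeasurable (Eventually.of_forall hA)
    obtain ⟨δ₁, hδ₁, A₁, hA₁⟩ := hb₁ y hy
    obtain ⟨δ₂, hδ₂, A₂, hA₂⟩ := hb₂ (-y) hy'
    have hΔy : Δ y = ∫ x, (F₁ (cpoint x y) - F₂ (cpoint x (-y))) * 𝓕 χ x := by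
      have e₂ := h₂ (-y) hy' χ hχ hc
      rw [neg_neg] at e₂
      simp only [Δ, sub_mul]
      rw [← h₁ y hy χ hχ hc, ← e₂, integral_sub
        (hi _ c₁ ⟨A₁, hA₁ y (Metric.mem_ball_self hδ₁)⟩)
        (hi _ c₂ ⟨A₂, hA₂ (-y) (Metric.mem_ball_self hδ₂)⟩)]
    rw [hΔy]
    exact enorm_integral_mul_fourier_le hpq hq (c₁.sub c₂).measurable.aemeasurable
      (hc.toSchwartzMap hχ)
  have hfb : fourierBound q χ < ⊤ := fourierBound_lt_top hq (hc.toSchwartzMap hχ)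
  have hΔ0 : Δ 0 = 0 := by
    by_contra hne
    set c := ‖Δ 0‖ₑ / 2
    have hc0 : 0 < c := ENNReal.div_pos (by simpa using hne) ENNReal.ofNat_ne_top
    have hclt : c < ‖Δ 0‖ₑ := ENNReal.half_lt_self (by simpa using hne) enorm_ne_top
    have hev : ∀ᶠ y in 𝓝[Γ] 0, (c / fourierBound q χ) ^ p ≤ N y := by
      filter_upwards [mem_nhdsWithin_of_mem_nhds
        (hΔc.enorm.continuousAt.eventually (lt_mem_nhds hclt)), self_mem_nhdsWithin] with y hy hyΓ
      have h1 : c ≤ N y ^ (1 / p) * fourierBound q χ := le_of_lt (lt_of_lt_of_le hy (hΔ y hyΓ))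
      have h2 : c / fourierBound q χ ≤ N y ^ (1 / p) := ENNReal.div_le_of_le_mul h1
      calc (c / fourierBound q χ) ^ p ≤ (N y ^ (1 / p)) ^ p := by gcongr
        _ = N y := by rw [← ENNReal.rpow_mul, one_div_mul_cancel hp.ne', ENNReal.rpow_one]
    have h3 : (c / fourierBound q χ) ^ p ≤ liminf N (𝓝[Γ] 0) :=
      le_liminf_of_le (by isBoundedDefault) hev
    rw [hlim] at h3
    have h4 : 0 < (c / fourierBound q χ) ^ p :=
      ENNReal.rpow_pos_of_nonneg (ENNReal.div_pos hc0.ne' hfb.ne) hp.le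
    exact absurd h3 (not_le.2 h4)
  have hz : ∀ f : RSpace n → ℂ, twist 0 f = f := fun f => by ext t; simp [twist]
  simpa [Δ, hz, sub_eq_zero] using hΔ0

/-! ### The bounded set of frequencies -/

/-- The set of frequencies `t` with `|t · y| ≤ C |y|` for all `y ∈ Γ`. -/
def frequencySet (Γ : Set (RSpace n)) (C : ℝ) : Set (RSpace n) :=
  {t | ∀ y ∈ Γ, |⟪t, y⟫| ≤ C * ‖y‖}

theorem isClosed_frequencySet (Γ : Set (RSpace n)) (C : ℝ) : IsClosed (frequencySet Γ C) := by
  have : frequencySet Γ C = ⋂ y ∈ Γ, {t | |⟪t, y⟫| ≤ C * ‖y‖} := by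
    ext t; simp [frequencySet]
  rw [this]
  exact isClosed_biInter fun y _ => isClosed_le (by fun_prop) continuous_const

theorem convex_frequencySet (Γ : Set (RSpace n)) (C : ℝ) : Convex ℝ (frequencySet Γ C) := by
  intro t ht u hu a b ha hb hab y hy
  rw [inner_add_left, inner_smul_left, inner_smul_left]
  simp only [conj_trivial]
  calc |a * ⟪t, y⟫ + b * ⟪u, y⟫| ≤ a * |⟪t, y⟫| + b * |⟪u, y⟫| := by
        refine (abs_add_le _ _).trans (le_of_eq ?_)
        rw [abs_mul, abs_mul, abs_of_nonneg ha, abs_of_nonneg hb]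
    _ ≤ a * (C * ‖y‖) + b * (C * ‖y‖) := by gcongr; exacts [ht y hy, hu y hy]
    _ = C * ‖y‖ := by rw [← add_mul, hab, one_mul]

/-- Moving `y₀` by a fixed length `c` in the direction of `t` stays in `Γ` and changes `t·y` by
`c|t|`. Both pairings are bounded by the constraint, hence so is `|t|`. The radius uses `|C|`
because `C` may be negative. -/
theorem isBounded_frequencySet {Γ : Set (RSpace n)} (hΓ : IsOpen Γ) {y₀ : RSpace n} (hy₀ : y₀ ∈ Γ)
    (C : ℝ) : Bornology.IsBounded (frequencySet Γ C) := by
  obtain ⟨κ, hκ, hsub⟩ := Metric.isOpen_iff.1 hΓ y₀ hy₀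
  set c := κ / 2
  have hc : 0 < c := half_pos hκ
  refine (Metric.isBounded_closedBall (x := (0 : RSpace n))
    (r := |C| * (2 * ‖y₀‖ + c) / c)).subset fun t ht => ?_
  rw [mem_closedBall_zero_iff, le_div_iff₀ hc]
  rcases eq_or_ne t 0 with rfl | h0
  · simp; positivity
  have htpos : 0 < ‖t‖ := norm_pos_iff.2 h0
  set e : RSpace n := (c / ‖t‖) • t with he
  have hen : ‖e‖ = c := by
    rw [he, norm_smul, Real.norm_eq_abs, abs_of_pos (div_pos hc htpos)]; field_simp
  have hmem : y₀ + e ∈ Γ := hsub (by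
    rw [mem_ball_iff_norm, add_sub_cancel_left, hen]; exact half_lt_self hκ)
  have h1 := (abs_le.1 (ht _ hmem)).2
  have h2 := (abs_le.1 (ht _ hy₀)).1
  have h3 : ⟪t, e⟫ = ‖t‖ * c := by
    rw [he, inner_smul_right, real_inner_self_eq_norm_sq]; field_simp
  rw [inner_add_right, h3] at h1
  have h4 : C * ‖y₀ + e‖ ≤ |C| * (‖y₀‖ + c) := by
    have h5 := norm_add_le y₀ e
    rw [hen] at h5
    calc C * ‖y₀ + e‖ ≤ |C| * ‖y₀ + e‖ := by gcongr; exact le_abs_self C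
      _ ≤ _ := by gcongr
  have h6 : C * ‖y₀‖ ≤ |C| * ‖y₀‖ := by gcongr; exact le_abs_self C
  linarith

/-! ### Linear growth of the weights and the entire extension -/

/-- A finite growth index gives a linear bound near infinity. -/
theorem exists_linear_bound_of_growthIndex_lt_top {Γ : Set (RSpace n)} (h0 : (0 : RSpace n) ∉ Γ)
    {ψ : RSpace n → ℝ} (h : growthIndex Γ ψ < ⊤) :
    ∃ C R : ℝ, ∀ y ∈ Γ, R ≤ ‖y‖ → ψ y ≤ C * ‖y‖ := by
  obtain ⟨C, hC, -⟩ := EReal.lt_iff_exists_real_btwn.1 h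
  have hev := eventually_lt_of_limsup_lt hC
  rw [eventually_inf_principal, ← comap_norm_atTop, eventually_comap] at hev
  obtain ⟨R, hR⟩ := eventually_atTop.1 hev
  refine ⟨C, R, fun y hy hyR => ?_⟩
  have hpos : 0 < ‖y‖ := norm_pos_iff.2 fun h => h0 (h ▸ hy)
  have h1 := hR ‖y‖ hyR y rfl hy
  exact ((div_lt_iff₀ hpos).1 (EReal.coe_lt_coe_iff.1 h1)).le

/-- Fourier inversion gives equality on every slice of finite norm. Such slices are dense and both
sides are continuous, so equality holds on the whole tube. -/
theorem MemBergman.eqOn_laplaceIntegral {p s : ℝ} (hp : 0 < p) (hs : 0 < s) {B : Set (RSpace n)}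
    (hB : IsOpen B) {ψ : RSpace n → ℝ} (hψ : ContinuousOn ψ B) {F : CSpace n → ℂ}
    (hF : MemBergman p s B ψ F) {f₀ f : RSpace n → ℂ} (hae : f₀ =ᵐ[volume] f)
    (hd : Differentiable ℂ (laplaceIntegral f)) (hint : ∀ y, Integrable (twist y f))
    (h : ∀ y ∈ B, sliceNorm p F y < ⊤ → ∀ h : SchwartzMap (RSpace n) ℂ,
      ∫ x, F (cpoint x y) * 𝓕 (h : RSpace n → ℂ) x = ∫ t, twist (-y) f₀ t * h t) :
    Set.EqOn (laplaceIntegral f) F (tube B) := by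
  have hgood : ∀ y ∈ B, sliceNorm p F y < ⊤ → ∀ x,
      laplaceIntegral f (cpoint x y) = F (cpoint x y) := by
    intro y hy hfin x
    have := eq_fourierInv_of_integral_mul_fourier_eq
      (continuous_slice hF.holomorphic.continuousOn hy) (hint (-y)) fun g => by
        rw [h y hy hfin g]
        refine integral_congr_ae ?_
        filter_upwards [hae] with t ht
        simp only [twist, ht]
    rw [laplaceIntegral_cpoint]
    exact (congrFun this x).symm
  rintro z ⟨x, y, hy, rfl⟩
  have hfr : ∃ᶠ η in 𝓝 y, laplaceIntegral f (cpoint x η) = F (cpoint x η) := by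
    rw [frequently_iff]
    intro U hU
    obtain ⟨ε, hε, hU⟩ := Metric.mem_nhds_iff.1 hU
    obtain ⟨η, hη, hd, hfin⟩ := hF.exists_sliceNorm_lt_top hp hs hB hψ hy hε
    exact ⟨η, hU hd, hgood η hη hfin x⟩
  have hc : ContinuousAt (fun η : RSpace n => cpoint x η) y :=
    (continuous_cpoint.comp (Continuous.prodMk_right x)).continuousAt
  have hFc : ContinuousAt F (cpoint x y) :=
    hF.holomorphic.continuousOn.continuousAt
      ((isOpen_tube hB).mem_nhds (cpoint_mem_tube.2 hy))
  have hLc : ContinuousAt (fun η : RSpace n => laplaceIntegral f (cpoint x η)) y :=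
    hd.continuous.continuousAt.comp (f := fun η : RSpace n => cpoint x η) hc
  have hFc' : ContinuousAt (fun η : RSpace n => F (cpoint x η)) y :=
    ContinuousAt.comp (f := fun η : RSpace n => cpoint x η) hFc hc
  by_contra hne
  have hev : ∀ᶠ η in 𝓝 y, laplaceIntegral f (cpoint x η) - F (cpoint x η) ≠ 0 :=
    (hLc.sub hFc').eventually_ne (sub_ne_zero.2 hne)
  exact hfr (hev.mono fun η hη => sub_ne_zero.1 hη)

end WeightedBergman

end

theorem theorem4 (n : ℕ) (Γ : Set (WeightedBergman.RSpace n))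
    (hΓ : WeightedBergman.IsRegularOpenConvexCone Γ)
    (ψ₁ ψ₂ : WeightedBergman.RSpace n → ℝ)
    (hψ₁ : ContinuousOn ψ₁ Γ) (hψ₂ : ContinuousOn ψ₂ (-Γ))
    (hR₁ : WeightedBergman.growthIndex Γ ψ₁ < ⊤)
    (hR₂ : WeightedBergman.growthIndex Γ (fun y => ψ₂ (-y)) < ⊤)
    (p s : ℝ) (hp₁ : 1 < p) (hp₂ : p ≤ 2) (hs₁ : 0 < s * (p - 1)) (hs₂ : s * (p - 1) ≤ 1)
    (F₁ F₂ : WeightedBergman.CSpace n → ℂ)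
    (hF₁ : WeightedBergman.MemBergman p s Γ ψ₁ F₁)
    (hF₂ : WeightedBergman.MemBergman p s (-Γ) ψ₂ F₂)
    (hlim : liminf (fun y : WeightedBergman.RSpace n =>
      ∫⁻ x : WeightedBergman.RSpace n,
        ‖F₁ (WeightedBergman.cpoint x y) - F₂ (WeightedBergman.cpoint x (-y))‖ₑ ^ p)
      (𝓝[Γ] 0) = 0) :
    ∃ F : WeightedBergman.CSpace n → ℂ,
      Differentiable ℂ F ∧
      Set.EqOn F F₁ (WeightedBergman.tube Γ) ∧
      Set.EqOn F F₂ (WeightedBergman.tube (-Γ)) ∧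
      ∃ (K : Set (WeightedBergman.RSpace n)) (f : WeightedBergman.RSpace n → ℂ),
        Bornology.IsBounded K ∧ Convex ℝ K ∧ Integrable f volume ∧ tsupport f ⊆ K ∧
        ∀ z : WeightedBergman.CSpace n,
          F z = ∫ t in K,
            f t * Complex.exp (2 * Real.pi * Complex.I * WeightedBergman.pairing t z) := by

  obtain ⟨C₁, R₁, hC₁⟩ :=
    WeightedBergman.exists_linear_bound_of_growthIndex_lt_top hΓ.zero_notMem hR₁
  obtain ⟨C₂, R₂, hC₂⟩ :=
    WeightedBergman.exists_linear_bound_of_growthIndex_lt_top hΓ.zero_notMem hR₂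
  have hΓ₁ := hΓ.toIsOpenConvexCone
  have hΓ₂ := hΓ₁.neg
  have hp0 : 0 < p := one_pos.trans hp₁
  have hs0 : 0 < s := pos_of_mul_pos_left hs₁ (sub_pos.2 hp₁).le
  set q := p.conjExponent
  have hpq : p.HolderConjugate q := Real.HolderConjugate.conjExponent hp₁
  have hq : 2 ≤ q := by
    change 2 ≤ p / (p - 1)
    rw [le_div_iff₀ (sub_pos.2 hp₁)]
    linarith
  set C := max C₁ C₂
  have hψ₁' : ∀ y ∈ Γ, R₁ ≤ ‖y‖ → ψ₁ y ≤ C * ‖y‖ := fun y hy hy' =>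
    (hC₁ y hy hy').trans (by gcongr; exact le_max_left _ _)
  have hψ₂' : ∀ y ∈ -Γ, R₂ ≤ ‖y‖ → ψ₂ y ≤ C * ‖y‖ := fun y hy hy' => by
    have h := hC₂ (-y) hy (by rwa [norm_neg])
    rw [neg_neg, norm_neg] at h
    exact h.trans (by gcongr; exact le_max_right _ _)
  obtain ⟨f₁, hl₁, ht₁, hz₁, hg₁⟩ := hF₁.exists_spectralFunction hpq hp₂ hq hs0 hΓ₁ hψ₁ hψ₁'
  obtain ⟨f₂, hl₂, ht₂, hz₂, hg₂⟩ := hF₂.exists_spectralFunction hpq hp₂ hq hs0 hΓ₂ hψ₂ hψ₂'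
  have hae : f₁ =ᵐ[volume] f₂ := WeightedBergman.ae_eq_of_liminf_eq_zero hpq hq
    hF₁.holomorphic.continuousOn hF₂.holomorphic.continuousOn
    (fun y hy => hF₁.exists_bound hp0 hs0 hΓ₁.isOpen hψ₁ hy)
    (fun y hy => hF₂.exists_bound hp0 hs0 hΓ₂.isOpen hψ₂ hy) hl₁ hl₂ ht₁ ht₂ hlim
  set K := WeightedBergman.frequencySet Γ C
  have hKc : IsClosed K := WeightedBergman.isClosed_frequencySet Γ C
  obtain ⟨y₀, hy₀⟩ := hΓ₁.nonempty
  have hKb : Bornology.IsBounded K := WeightedBergman.isBounded_frequencySet hΓ₁.isOpen hy₀ C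
  have hKcomp : IsCompact K := Metric.isCompact_of_isClosed_isBounded hKc hKb
  -- The spectral function is determined only almost everywhere; cutting it off makes it vanish at
  -- every point outside `K`.
  set f := K.indicator f₁
  have hf₁ : f₁ =ᵐ[volume] f := by
    filter_upwards [hae, hz₁, hz₂] with t e₁ e₂ e₃
    by_cases ht : t ∈ K
    · exact (Set.indicator_of_mem ht f₁).symm
    · refine Eq.trans ?_ (Set.indicator_of_notMem ht f₁).symm
      obtain ⟨y, hy, hty⟩ : ∃ y ∈ Γ, C * ‖y‖ < |inner ℝ t y| := by
        by_contra! hcon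
        exact ht hcon
      -- If `t·y > C|y|`, the height `-y ∈ -Γ` excludes `t` from the spectrum of `F₂`, and `f₁ = f₂`
      -- there. If `t·y < -C|y|`, then `y` itself excludes it from that of `F₁`.
      rcases lt_abs.1 hty with h | h
      · rw [e₁]
        refine e₃ ⟨-y, by simpa using hy, ?_⟩
        rw [inner_neg_right, norm_neg]
        linarith
      · exact e₂ ⟨y, hy, by linarith⟩
  have hf₂ : f₂ =ᵐ[volume] f := hae.symm.trans hf₁
  have hfK : ∀ t, t ∉ K → f t = 0 := fun t ht => Set.indicator_of_notMem ht f₁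
  have hint : ∀ y, Integrable (WeightedBergman.twist y f) := fun y => by
    have h1 : WeightedBergman.twist y f = K.indicator (WeightedBergman.twist y f₁) := by
      ext t
      by_cases ht : t ∈ K
      · simp [f, WeightedBergman.twist, ht]
      · simp [f, WeightedBergman.twist, ht]
    rw [h1, integrable_indicator_iff hKc.measurableSet]
    exact (WeightedBergman.locallyIntegrable_twist y hl₁).integrableOn_isCompact hKcomp
  have hfi : Integrable f := by
    have h1 : WeightedBergman.twist 0 f = f := by ext t; simp [WeightedBergman.twist]
    exact h1 ▸ hint 0
  have hd := WeightedBergman.differentiable_laplaceIntegral hfi hKb hfK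
  refine ⟨WeightedBergman.laplaceIntegral f, hd,
    hF₁.eqOn_laplaceIntegral hp0 hs0 hΓ₁.isOpen hψ₁ hf₁ hd hint hg₁,
    hF₂.eqOn_laplaceIntegral hp0 hs0 hΓ₂.isOpen hψ₂ hf₂ hd hint hg₂,
    K, f, hKb, WeightedBergman.convex_frequencySet Γ C, hfi,
    closure_minimal (fun t ht => by_contra fun h => ht (hfK t h)) hKc, fun z => ?_⟩
  exact (setIntegral_eq_integral_of_forall_compl_eq_zero fun t ht => by
    rw [hfK t ht, zero_mul]).symm
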